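/- Let $X=\{x_0,x_1\}$ and let $\mathbb{C}\langle X\rangle\subset\mathbb{C}\langle\langle X\rangle\rangle$ be the noncommutative polynomials and formal power series over $X$; both are commutative unital algebras for the shuffle product $\sqcup\!\sqcup$, with unit the empty word $1_{X^*}$. For a series $S$ without constant term let $S^*=\sum_{n\ge 0}S^n$ (concatenation powers) be its Kleene star. Let $\Omega=\mathbb{C}\setminus(\,]-\infty,0]\cup[1,+\infty[\,)$, let $\mathcal{H}(\Omega)$ be the algebra of holomorphic functions on $\Omega$, and let $\mathcal{C}=\mathbb{C}[z,z^{-1},(1-z)^{-1}]\subset\mathcal{H}(\Omega)$. The polylogarithms $\mathrm{Li}_w\in\mathcal{H}(\Omega)$, $w\in X^*$, are defined, with the principal logarithm, by $\mathrm{Li}_{x_0^n}(z)=\log^n(z)/n!$ for $n\ge 0$, $\mathrm{Li}_{x_1w}(z)=\int_0^z\mathrm{Li}_w(s)\,\frac{ds}{1-s}$ for every $w\in X^*$, and $\mathrm{Li}_{x_0w}(z)=\int_0^z\mathrm{Li}_w(s)\,\frac{ds}{s}$ if the letter $x_1$ occurs in $w$. **Theorem.** Let $A=(\mathbb{C}\langle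 X\rangle,\sqcup\!\sqcup,1_{X^*})[x_0^*,(-x_0)^*,x_1^*]$ be the subalgebra of $(\mathbb{C}\langle\langle X\rangle\rangle,\sqcup\!\sqcup,1_{X^*})$ generated by $\mathbb{C}\langle X\rangle$ and the series $x_0^*,(-x_0)^*,x_1^*$. There is a unique morphism of unital $\mathbb{C}$-algebras $\mathrm{Li}^{(1)}_\bullet:A\to\mathcal{H}(\Omega)$ such that $\mathrm{Li}^{(1)}_w=\mathrm{Li}_w$ for every word $w\in X^*$ and $$\mathrm{Li}^{(1)}_{x_0^*}=z,\qquad \mathrm{Li}^{(1)}_{(-x_0)^*}=z^{-1},\qquad \mathrm{Li}^{(1)}_{x_1^*}=(1-z)^{-1}.$$ Its image is $\mathcal{C}\{\mathrm{Li}_w\}_{w\in X^*}$, the $\mathcal{C}$-linear span of the functions $\mathrm{Li}_w$, which is also the $\mathcal{C}$-subalgebra that they generate. Its kernel is the ideal of $A$ generated by $x_0^*\mathbin{\sqcup\!\sqcup} x_1^*-x_1^*+1_{X^*}$. -/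

import Mathlib

namespace PolylogExt

/-- The alphabet `X = {x₀, x₁}`. Words in `X*` are lists of letters. -/
inductive Letter
  | x0
  | x1
  deriving DecidableEq

/-! ### Noncommutative series and the shuffle product -/

/-- `ℂ⟨⟨X⟩⟩`: noncommutative formal power series, i.e. functions `w ↦ ⟨S | w⟩` on words. -/
structure Series where
  /-- The coefficient `⟨S | w⟩`. -/
  coeff : List Letter → ℂ

namespace Series

instance : CoeFun Series (fun _ => List Letter → ℂ) := ⟨coeff⟩

@[ext] theorem ext {S T : Series} (h : ∀ w, S w = T w) : S = T := by
  cases S; cases T; congr; exact funext h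

/-- A series is the family of its coefficients. -/
def equivFun : Series ≃ (List Letter → ℂ) := ⟨coeff, mk, fun _ => rfl, fun _ => rfl⟩

/-! The vector space structure is coefficientwise. -/
noncomputable instance : AddCommGroup Series := equivFun.addCommGroup
noncomputable instance : Module ℂ Series := equivFun.module ℂ

@[simp] theorem add_apply (S T : Series) (w : List Letter) : (S + T) w = S w + T w := rfl
@[simp] theorem neg_apply (S : Series) (w : List Letter) : (-S) w = -S w := rfl
@[simp] theorem zero_apply (w : List Letter) : (0 : Series) w = 0 := rfl
@[simp] theorem smul_apply (c : ℂ) (S : Series) (w : List Letter) : (c • S) w = c * S w := rfl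

/-- The series reduced to the single word `u`. -/
def word (u : List Letter) : Series := ⟨fun w => if w = u then 1 else 0⟩

/-- The residual `a⁻¹S`, with `⟨a⁻¹S | w⟩ = ⟨S | a w⟩`. -/
def residual (a : Letter) (S : Series) : Series := ⟨fun w => S (a :: w)⟩

@[simp] theorem residual_apply (a : Letter) (S : Series) (w : List Letter) :
    residual a S w = S (a :: w) := rfl
@[simp] theorem residual_add (a : Letter) (S T : Series) :
    residual a (S + T) = residual a S + residual a T := rfl
@[simp] theorem residual_zero (a : Letter) : residual a 0 = 0 := rfl
@[simp] theorem residual_smul (a : Letter) (c : ℂ) (S : Series) :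
    residual a (c • S) = c • residual a S := rfl

/-- `shuffleCoeff w S T = ⟨S ⧢ T | w⟩ = ∑ ⟨S | w_I⟩ ⟨T | w_J⟩`, the sum being over all splittings
of the positions of `w` into two complementary sets `I` and `J`
(the first letter of `w` belongs either to the first or to the second subword). -/
def shuffleCoeff : List Letter → Series → Series → ℂ
  | [], S, T => S [] * T []
  | a :: w, S, T => shuffleCoeff w (residual a S) T + shuffleCoeff w S (residual a T)

/-- Multiplication of series is the shuffle product `⧢`. -/
instance : Mul Series := ⟨fun S T => ⟨fun w => shuffleCoeff w S T⟩⟩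

/-- The unit is the empty word `1_{X*}`. -/
instance : One Series := ⟨word []⟩

@[simp] theorem mul_nil (S T : Series) : (S * T) [] = S [] * T [] := rfl
theorem mul_cons (S T : Series) (a : Letter) (w : List Letter) :
    (S * T) (a :: w) = (residual a S * T) w + (S * residual a T) w := rfl
@[simp] theorem residual_mul (a : Letter) (S T : Series) :
    residual a (S * T) = residual a S * T + S * residual a T := rfl
@[simp] theorem one_nil : (1 : Series) [] = 1 := rfl
@[simp] theorem residual_one (a : Letter) : residual a (1 : Series) = 0 := by
  ext w; show (if a :: w = [] then (1 : ℂ) else 0) = 0; simp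

theorem zero_mul_apply (w : List Letter) : ∀ S : Series, (0 * S) w = 0 := by
  induction w with
  | nil => intro S; simp
  | cons a w ih => intro S; rw [mul_cons, residual_zero, ih, ih, add_zero]

theorem mul_comm_apply (w : List Letter) : ∀ S T : Series, (S * T) w = (T * S) w := by
  induction w with
  | nil => intro S T; simp [mul_comm]
  | cons a w ih => intro S T; rw [mul_cons, mul_cons, ih, ih S, add_comm]

theorem one_mul_apply (w : List Letter) : ∀ S : Series, (1 * S) w = S w := by
  induction w with
  | nil => intro S; simp
  | cons a w ih => intro S; rw [mul_cons, residual_one, ih, zero_mul_apply, zero_add]; rfl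

theorem add_mul_apply (w : List Letter) :
    ∀ R S T : Series, ((R + S) * T) w = (R * T) w + (S * T) w := by
  induction w with
  | nil => intro R S T; simp [add_mul]
  | cons a w ih => intro R S T; simp only [mul_cons, residual_add, ih]; ring

theorem smul_mul_apply (w : List Letter) :
    ∀ (c : ℂ) (S T : Series), ((c • S) * T) w = c * (S * T) w := by
  induction w with
  | nil => intro c S T; simp [mul_assoc]
  | cons a w ih => intro c S T; simp only [mul_cons, residual_smul, ih]; ring

theorem mul_add_apply (w : List Letter) (R S T : Series) :
    (R * (S + T)) w = (R * S) w + (R * T) w := by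
  rw [mul_comm_apply, add_mul_apply, mul_comm_apply w S, mul_comm_apply w T]

theorem mul_assoc_apply (w : List Letter) :
    ∀ R S T : Series, ((R * S) * T) w = (R * (S * T)) w := by
  induction w with
  | nil => intro R S T; simp [mul_assoc]
  | cons a w ih =>
    intro R S T
    simp only [mul_cons, residual_mul, add_mul_apply, mul_add_apply, ih]
    ring

/-- `(ℂ⟨⟨X⟩⟩, +, ⧢)` is a commutative ring. -/
noncomputable instance : CommRing Series :=
  { (inferInstance : AddCommGroup Series), (inferInstance : Mul Series),
    (inferInstance : One Series) with
    left_distrib := fun R S T => ext fun w => mul_add_apply w R S T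
    right_distrib := fun R S T => ext fun w => add_mul_apply w R S T
    zero_mul := fun S => ext fun w => zero_mul_apply w S
    mul_zero := fun S => ext fun w => by rw [mul_comm_apply, zero_mul_apply]; rfl
    mul_assoc := fun R S T => ext fun w => mul_assoc_apply w R S T
    one_mul := fun S => ext fun w => one_mul_apply w S
    mul_one := fun S => ext fun w => by rw [mul_comm_apply, one_mul_apply]
    mul_comm := fun S T => ext fun w => mul_comm_apply w S T }

noncomputable instance : Algebra ℂ Series :=
  Algebra.ofModule (fun c S T => ext fun w => smul_mul_apply w c S T)
    (fun c S T => ext fun w => by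
      rw [mul_comm_apply, smul_mul_apply, mul_comm_apply]; rfl)

/-! ### Concatenation and the Kleene star -/

/-- The concatenation product, `⟨S · T | w⟩ = ∑_{w = uv} ⟨S | u⟩ ⟨T | v⟩`. -/
noncomputable def conc (S T : Series) : Series :=
  ⟨fun w => ∑ i ∈ Finset.range (w.length + 1), S (w.take i) * T (w.drop i)⟩

/-- The powers `Sⁿ` for the concatenation product. -/
noncomputable def concPow (S : Series) : ℕ → Series
  | 0 => 1
  | n + 1 => conc S (concPow S n)

/-- The Kleene star `S* = 1 + S + S² + ⋯` (concatenation powers) of a series `S` with zero constant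
term. For such `S` the words of `Sⁿ` have length at least `n`, so that only the powers `n ≤ |w|`
contribute to the coefficient of `w`. -/
noncomputable def kleeneStar (S : Series) : Series :=
  ⟨fun w => ∑ n ∈ Finset.range (w.length + 1), concPow S n w⟩

/-- The star `x₀*`. -/
noncomputable def x0Star : Series := kleeneStar (word [Letter.x0])

/-- The star `(-x₀)*`. -/
noncomputable def negX0Star : Series := kleeneStar (-word [Letter.x0])

/-- The star `x₁*`. -/
noncomputable def x1Star : Series := kleeneStar (word [Letter.x1])

/-- `ℂ⟨X⟩`: the noncommutative polynomials, i.e. the series of finite support. -/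
def polynomials : Set Series := {S | {w : List Letter | S w ≠ 0}.Finite}

theorem word_mem_polynomials (u : List Letter) : word u ∈ polynomials := by
  refine (Set.finite_singleton u).subset fun w hw => ?_
  by_contra h
  exact hw (if_neg h)

end Series

open Series

/-- The algebra `(ℂ⟨X⟩, ⧢, 1)[x₀*, (-x₀)*, x₁*]`, as a subalgebra of `(ℂ⟨⟨X⟩⟩, ⧢)`. -/
noncomputable def Dom : Subalgebra ℂ Series :=
  Algebra.adjoin ℂ (polynomials ∪ {x0Star, negX0Star, x1Star})

namespace Dom

/-- A word as an element of `Dom`. -/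
noncomputable def word (w : List Letter) : Dom :=
  ⟨Series.word w, Algebra.subset_adjoin (Or.inl (word_mem_polynomials w))⟩

/-- `x₀*` as an element of `Dom`. -/
noncomputable def x0Star : Dom :=
  ⟨Series.x0Star, Algebra.subset_adjoin (Or.inr (by simp))⟩

/-- `(-x₀)*` as an element of `Dom`. -/
noncomputable def negX0Star : Dom :=
  ⟨Series.negX0Star, Algebra.subset_adjoin (Or.inr (by simp))⟩

/-- `x₁*` as an element of `Dom`. -/
noncomputable def x1Star : Dom :=
  ⟨Series.x1Star, Algebra.subset_adjoin (Or.inr (by simp))⟩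

end Dom

/-! ### Polylogarithms on the cleft plane -/

/-- The cleft plane `Ω = ℂ \ (]-∞, 0] ∪ [1, +∞[)`. -/
def Omega : Set ℂ := {z | ¬ (z.im = 0 ∧ (z.re ≤ 0 ∨ 1 ≤ z.re))}

/-- The algebra `H(Ω)` of holomorphic functions on `Ω`. -/
def Hol : Subalgebra ℂ (Omega → ℂ) where
  carrier := {f | ∃ F : ℂ → ℂ, DifferentiableOn ℂ F Omega ∧ ∀ z : Omega, f z = F z}
  mul_mem' := by
    rintro f g ⟨F, hF, hf⟩ ⟨G, hG, hg⟩
    exact ⟨fun z => F z * G z, hF.mul hG, fun z => by simp [hf, hg]⟩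
  add_mem' := by
    rintro f g ⟨F, hF, hf⟩ ⟨G, hG, hg⟩
    exact ⟨fun z => F z + G z, hF.add hG, fun z => by simp [hf, hg]⟩
  algebraMap_mem' := fun c => ⟨fun _ => c, differentiableOn_const c, fun _ => rfl⟩

open Classical in
/-- The polylogarithms, as iterated integrals for `ω₀ = dz/z` and `ω₁ = dz/(1-z)`:
`Li_1 = 1`, `Li_{x₁w}(z) = ∫_0^z Li_w(s) ds/(1-s)`, `Li_{x₀w}(z) = ∫_0^z Li_w(s) ds/s` when the
letter `x₁` occurs in `w`, and `Li_{x₀ⁿ}(z) = log(z)ⁿ/n!`. The integrals are taken along the segment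
`s = t z`, `t ∈ [0, 1]`, which lies in `Ω` apart from its origin; the integrands are integrable. -/
noncomputable def Li : List Letter → ℂ → ℂ
  | [], _ => 1
  | Letter.x0 :: w, z =>
      if Letter.x1 ∈ w then ∫ t in (0 : ℝ)..1, Li w (t * z) / t
      else Complex.log z ^ (w.length + 1) / ((w.length + 1).factorial : ℂ)
  | Letter.x1 :: w, z => ∫ t in (0 : ℝ)..1, Li w (t * z) * (z / (1 - t * z))

/-- `Li_w` as a function on `Ω`. -/
noncomputable def LiOn (w : List Letter) : Omega → ℂ := fun z => Li w z

/-- The function `z` on `Ω`. -/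
def fz : Omega → ℂ := fun z => z

/-- The function `1/z` on `Ω`. -/
noncomputable def fzInv : Omega → ℂ := fun z => (z : ℂ)⁻¹

/-- The function `1/(1-z)` on `Ω`. -/
noncomputable def fOneSubInv : Omega → ℂ := fun z => (1 - (z : ℂ))⁻¹

/-- The ring `𝒞 = ℂ[z, z⁻¹, (1-z)⁻¹]` of functions on `Ω`. -/
noncomputable def CC : Subalgebra ℂ (Omega → ℂ) := Algebra.adjoin ℂ {fz, fzInv, fOneSubInv}

/-- The defining values of the morphism `Li⁽¹⁾`. -/
structure IsLiOne (Φ : Dom →ₐ[ℂ] Hol) : Prop where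
  word : ∀ w : List Letter, (Φ (Dom.word w) : Omega → ℂ) = LiOn w
  x0Star : (Φ Dom.x0Star : Omega → ℂ) = fz
  negX0Star : (Φ Dom.negX0Star : Omega → ℂ) = fzInv
  x1Star : (Φ Dom.x1Star : Omega → ℂ) = fOneSubInv

end PolylogExt

namespace PolylogExt

/-! ### Words of bounded length and polynomials -/

/-- The words of length less than `n`. -/
def wordsLT : ℕ → Finset (List Letter)
  | 0 => ∅
  | n + 1 => insert [] ((wordsLT n).image (List.cons Letter.x0) ∪
      (wordsLT n).image (List.cons Letter.x1))

theorem mem_wordsLT {n : ℕ} : ∀ {w : List Letter}, w ∈ wordsLT n ↔ w.length < n := by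
  induction n with
  | zero => intro w; simp [wordsLT]
  | succ n ih =>
    intro w
    rcases w with _ | ⟨a, w⟩
    · simp [wordsLT]
    · cases a <;> simp [wordsLT, ih]

theorem sum_wordsLT_succ {M : Type*} [AddCommMonoid M] (n : ℕ) (f : List Letter → M) :
    ∑ w ∈ wordsLT (n + 1), f w = f [] + (∑ w ∈ wordsLT n, f (Letter.x0 :: w) +
      ∑ w ∈ wordsLT n, f (Letter.x1 :: w)) := by
  rw [wordsLT, Finset.sum_insert (by simp), Finset.sum_union, Finset.sum_image (by simp),
    Finset.sum_image (by simp)]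
  rw [Finset.disjoint_left]
  simp

namespace Series

theorem ext_residual {S T : Series} (h : S [] = T []) (h' : ∀ a, residual a S = residual a T) :
    S = T := by
  ext w
  rcases w with _ | ⟨a, w⟩
  · exact h
  · exact congrArg (fun R : Series => R w) (h' a)

/-- All words of the series `S` have length less than `N`. -/
def LengthLT (N : ℕ) (S : Series) : Prop := ∀ w : List Letter, N ≤ w.length → S w = 0

theorem LengthLT.mono {N M : ℕ} {S : Series} (h : LengthLT N S) (hNM : N ≤ M) : LengthLT M S :=
  fun w hw => h w (hNM.trans hw)

theorem LengthLT.eq_zero {S : Series} (h : LengthLT 0 S) : S = 0 := ext fun w => h w (Nat.zero_le _)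

theorem LengthLT.residual {N : ℕ} {S : Series} (h : LengthLT (N + 1) S) (a : Letter) :
    LengthLT N (residual a S) := fun w hw => h (a :: w) (by simpa using hw)

theorem LengthLT.add {N : ℕ} {S T : Series} (hS : LengthLT N S) (hT : LengthLT N T) :
    LengthLT N (S + T) := fun w hw => by simp [hS w hw, hT w hw]

theorem LengthLT.smul {N : ℕ} {S : Series} (hS : LengthLT N S) (c : ℂ) :
    LengthLT N (c • S) := fun w hw => by simp [hS w hw]

theorem LengthLT.mul {N M : ℕ} {S T : Series} (hS : LengthLT N S) (hT : LengthLT M T) :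
    LengthLT (N + M) (S * T) := by
  intro w
  induction w generalizing N M S T with
  | nil =>
    intro hw
    rw [mul_nil, hS [] (by simp at hw ⊢; omega), zero_mul]
  | cons a w ih =>
    intro hw
    rcases N with _ | N
    · rw [hS.eq_zero, zero_mul]; rfl
    rcases M with _ | M
    · rw [hT.eq_zero, mul_zero]; rfl
    simp only [List.length_cons] at hw
    rw [mul_cons, ih (hS.residual a) hT (by omega), ih hS (hT.residual a) (by omega), add_zero]

theorem lengthLT_word (u : List Letter) : LengthLT (u.length + 1) (word u) := by
  intro w hw
  refine if_neg ?_
  rintro rfl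
  omega

theorem mem_polynomials_iff {S : Series} : S ∈ polynomials ↔ ∃ N, LengthLT N S := by
  constructor
  · intro h
    obtain ⟨N, hN⟩ := (h.image List.length).bddAbove
    refine ⟨N + 1, fun w hw => ?_⟩
    by_contra hne
    have := hN ⟨w, hne, rfl⟩
    omega
  · rintro ⟨N, hN⟩
    refine (wordsLT N).finite_toSet.subset fun w hw => ?_
    rw [Finset.mem_coe, mem_wordsLT]
    by_contra h
    exact hw (hN w (by omega))

theorem LengthLT.eq_sum {N : ℕ} {S : Series} (h : LengthLT N S) :
    S = ∑ w ∈ wordsLT N, S w • word w := by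
  have key : ∀ (s : Finset (List Letter)) (v : List Letter),
      (∑ w ∈ s, S w • word w) v = ∑ w ∈ s, S w * (word w) v := by
    intro s v
    induction s using Finset.cons_induction with
    | empty => simp
    | cons a s ha ih => rw [Finset.sum_cons, Finset.sum_cons, add_apply, ih, smul_apply]
  ext v
  rw [key]
  by_cases hv : v ∈ wordsLT N
  · rw [Finset.sum_eq_single v]
    · simp [word]
    · intro w _ hw
      simp [word, hw.symm]
    · exact fun h' => absurd hv h'
  · rw [h v (by rw [mem_wordsLT] at hv; omega), Finset.sum_eq_zero]
    intro w hw
    have : v ≠ w := by rintro rfl; exact hv hw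
    simp [word, this]

/-- The shuffle algebra of noncommutative polynomials. -/
noncomputable def NCPoly : Subalgebra ℂ Series where
  carrier := polynomials
  mul_mem' := by
    intro S T hS hT
    rw [mem_polynomials_iff] at *
    obtain ⟨N, hN⟩ := hS
    obtain ⟨M, hM⟩ := hT
    exact ⟨_, hN.mul hM⟩
  add_mem' := by
    intro S T hS hT
    rw [mem_polynomials_iff] at *
    obtain ⟨N, hN⟩ := hS
    obtain ⟨M, hM⟩ := hT
    exact ⟨max N M, (hN.mono (le_max_left _ _)).add (hM.mono (le_max_right _ _))⟩
  algebraMap_mem' := by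
    intro c
    rw [mem_polynomials_iff]
    refine ⟨1, ?_⟩
    rw [Algebra.algebraMap_eq_smul_one]
    exact (lengthLT_word []).smul c

theorem mem_NCPoly_iff {S : Series} : S ∈ NCPoly ↔ ∃ N, LengthLT N S := mem_polynomials_iff

theorem residual_word_cons (a b : Letter) (w : List Letter) :
    residual a (word (b :: w)) = if a = b then word w else 0 := by
  ext v
  split_ifs with h
  · simp [word, h]
  · simp [word, h]

/-! ### Stars of letters -/

/-- The series `(c a)*` of a letter `a`, for `c ∈ ℂ`. -/
noncomputable def letterStar (a : Letter) (c : ℂ) : Series := by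
  classical
  exact ⟨fun w => if ∀ b ∈ w, b = a then c ^ w.length else 0⟩

@[simp] theorem letterStar_nil (a : Letter) (c : ℂ) : letterStar a c [] = 1 := by
  simp [letterStar]

theorem residual_letterStar (a b : Letter) (c : ℂ) :
    residual b (letterStar a c) = if b = a then c • letterStar a c else 0 := by
  ext w
  split_ifs with h
  · simp [letterStar, h, pow_succ, mul_comm]
  · simp [letterStar, h]

theorem letterStar_zero (a : Letter) : letterStar a 0 = 1 := by
  refine ext_residual (by simp) fun b => ?_
  rw [residual_letterStar, residual_one, zero_smul, ite_self]

theorem letterStar_mul (a : Letter) (c d : ℂ) :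
    letterStar a c * letterStar a d = letterStar a (c + d) := by
  ext w
  induction w with
  | nil => simp
  | cons b w ih =>
    rw [← residual_apply, ← residual_apply, residual_mul, residual_letterStar,
      residual_letterStar, residual_letterStar]
    split_ifs with h
    · rw [smul_mul_assoc, mul_smul_comm, ← add_smul, smul_apply, ih, smul_apply]
    · simp

theorem letterStar_pow (a : Letter) (c : ℂ) (n : ℕ) :
    letterStar a c ^ n = letterStar a (n * c) := by
  induction n with
  | zero => simp [letterStar_zero]
  | succ n ih =>
    rw [pow_succ, ih, letterStar_mul]
    congr 1
    push_cast
    ring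

theorem conc_letter_cons (a b : Letter) (c : ℂ) (T : Series) (w : List Letter) :
    conc (c • word [a]) T (b :: w) = if b = a then c * T w else 0 := by
  show ∑ i ∈ Finset.range ((b :: w).length + 1), _ = _
  rw [Finset.sum_eq_single 1]
  · split_ifs with h <;> simp [word, h]
  · intro i hi hi1
    have hne : (b :: w).take i ≠ [a] := by
      intro h
      have := congrArg List.length h
      simp only [List.length_take, List.length_cons, List.length_nil, Finset.mem_range] at this hi
      omega
    simp [word, hne]
  · intro h
    simp at h

theorem kleeneStar_letter (a : Letter) (c : ℂ) :
    kleeneStar (c • word [a]) = letterStar a c := by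
  ext w
  induction w with
  | nil => simp [kleeneStar, concPow]
  | cons b w ih =>
    rw [← residual_apply b (letterStar a c), residual_letterStar]
    show ∑ n ∈ Finset.range ((b :: w).length + 1), concPow (c • word [a]) n (b :: w) = _
    have h0 : (1 : Series) (b :: w) = 0 := by
      rw [← residual_apply, residual_one, zero_apply]
    rw [Finset.sum_range_succ']
    simp only [concPow, conc_letter_cons, h0, add_zero]
    split_ifs with h
    · rw [← Finset.mul_sum, smul_apply, ← ih]
      rfl
    · simp

theorem x0Star_eq : x0Star = letterStar Letter.x0 1 := by
  rw [← kleeneStar_letter, one_smul]; rfl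

theorem negX0Star_eq : negX0Star = letterStar Letter.x0 (-1) := by
  rw [← kleeneStar_letter, neg_one_smul]; rfl

theorem x1Star_eq : x1Star = letterStar Letter.x1 1 := by
  rw [← kleeneStar_letter, one_smul]; rfl

/-! ### Independence of the stars over the polynomials -/

/-- The derivation `x₀⁻¹ + i x₁⁻¹` of the shuffle algebra. -/
noncomputable def mixedResidual : Module.End ℂ Series where
  toFun S := residual Letter.x0 S + Complex.I • residual Letter.x1 S
  map_add' S T := by simp only [residual_add, smul_add]; abel
  map_smul' c S := by
    simp only [residual_smul, smul_add, RingHom.id_apply]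
    rw [smul_comm]

theorem mixedResidual_mul (S T : Series) :
    mixedResidual (S * T) = mixedResidual S * T + S * mixedResidual T := by
  simp only [mixedResidual, LinearMap.coe_mk, AddHom.coe_mk, residual_mul, add_mul, mul_add,
    smul_add, smul_mul_assoc, mul_smul_comm]
  abel

/-- The series `(k x₀)* ⧢ (l x₁)*`. -/
noncomputable def starMonomial (k l : ℂ) : Series :=
  letterStar Letter.x0 k * letterStar Letter.x1 l

theorem starMonomial_mul (k l k' l' : ℂ) :
    starMonomial k l * starMonomial k' l' = starMonomial (k + k') (l + l') := by
  rw [starMonomial, starMonomial, starMonomial, ← letterStar_mul, ← letterStar_mul]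
  ring

theorem starMonomial_zero : starMonomial 0 0 = 1 := by
  rw [starMonomial, letterStar_zero, letterStar_zero, one_mul]

theorem mixedResidual_starMonomial (k l : ℂ) :
    mixedResidual (starMonomial k l) = (k + Complex.I * l) • starMonomial k l := by
  rw [starMonomial, mixedResidual_mul]
  simp [mixedResidual, residual_letterStar, add_smul, mul_smul]

theorem mul_starMonomial_mem {N : ℕ} {P : Series} (hP : LengthLT N P) (k l : ℂ) :
    P * starMonomial k l ∈ mixedResidual.maxGenEigenspace (k + Complex.I * l) := by
  rw [Module.End.mem_maxGenEigenspace]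
  refine ⟨N, ?_⟩
  induction N generalizing P with
  | zero => rw [hP.eq_zero, zero_mul, map_zero]
  | succ N ih =>
    have h : (mixedResidual - (k + Complex.I * l) • 1) (P * starMonomial k l) =
        mixedResidual P * starMonomial k l := by
      rw [LinearMap.sub_apply, mixedResidual_mul, mixedResidual_starMonomial]
      simp
    rw [pow_succ, Module.End.mul_apply, h]
    exact ih ((hP.residual _).add ((hP.residual _).smul _))

theorem mul_starMonomial_eq_zero {P : Series} {k l : ℂ} (h : P * starMonomial k l = 0) :
    P = 0 := by
  have h2 : starMonomial k l * starMonomial (-k) (-l) = 1 := by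
    rw [starMonomial_mul, add_neg_cancel, add_neg_cancel, starMonomial_zero]
  rw [← mul_one P, ← h2, ← mul_assoc, h, zero_mul]

end Series
end PolylogExt

namespace PolylogExt
open Series

/-! ### The domain as a Laurent-type polynomial algebra -/

/-- The polynomials in `x₀*`, its inverse and `x₁*` with coefficients in `ℂ⟨X⟩`. -/
abbrev StarPoly := AddMonoidAlgebra NCPoly (ℤ × ℕ)

/-- The character `(k, l) ↦ (k x₀)* ⧢ (l x₁)*`. -/
noncomputable def starChar : Multiplicative (ℤ × ℕ) →* Series where
  toFun p := starMonomial (p.toAdd.1 : ℂ) (p.toAdd.2 : ℂ)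
  map_one' := by simp [starMonomial_zero]
  map_mul' p q := by simp [starMonomial_mul]

/-- The evaluation of a polynomial in the stars as a series. -/
noncomputable def toSeries : StarPoly →ₐ[ℂ] Series :=
  AddMonoidAlgebra.liftNCAlgHom NCPoly.val starChar fun _ _ => Commute.all _ _

theorem toSeries_single (p : ℤ × ℕ) (P : NCPoly) :
    toSeries (AddMonoidAlgebra.single p P) = P * starMonomial (p.1 : ℂ) (p.2 : ℂ) :=
  AddMonoidAlgebra.liftNC_single _ _ _ _

theorem toSeries_apply (x : StarPoly) :
    toSeries x = ∑ p ∈ x.coeff.support, (x.coeff p : Series) * starMonomial (p.1 : ℂ) (p.2 : ℂ) :=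
  rfl

theorem toSeries_injective : Function.Injective toSeries := by
  rw [injective_iff_map_eq_zero]
  intro x hx
  rw [toSeries_apply] at hx
  have hinj : Function.Injective
      (fun p : ℤ × ℕ => ((p.1 : ℂ) + Complex.I * (p.2 : ℂ))) := by
    intro p q h
    have h1 := congrArg Complex.re h
    have h2 := congrArg Complex.im h
    simp only [Complex.add_re, Complex.add_im, Complex.intCast_re, Complex.intCast_im,
      Complex.I_mul_re, Complex.I_mul_im, Complex.natCast_re, Complex.natCast_im, neg_zero,
      add_zero, zero_add] at h1 h2
    exact Prod.ext (by exact_mod_cast h1) (by exact_mod_cast h2)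
  have hind := (mixedResidual.independent_maxGenEigenspace).comp hinj
  rw [iSupIndep_iff_finsetSum_eq_zero_imp_eq_zero] at hind
  have hz := hind x.coeff.support
    (fun p => (x.coeff p : Series) * starMonomial (p.1 : ℂ) (p.2 : ℂ))
    (fun p _ => by
      obtain ⟨N, hN⟩ := mem_NCPoly_iff.1 (x.coeff p).2
      exact mul_starMonomial_mem hN _ _) hx
  ext p w
  by_cases hp : p ∈ x.coeff.support
  · have := mul_starMonomial_eq_zero (hz p hp)
    rw [this]; rfl
  · rw [Finsupp.notMem_support_iff.1 hp]; rfl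

theorem NCPoly_le_Dom : NCPoly ≤ Dom := fun _ hS => Algebra.subset_adjoin (Or.inl hS)

theorem starMonomial_mem_Dom (k : ℤ) (l : ℕ) : starMonomial (k : ℂ) (l : ℂ) ∈ Dom := by
  refine mul_mem ?_ ?_
  · obtain ⟨n, rfl | rfl⟩ := k.eq_nat_or_neg
    · have : x0Star ^ n ∈ Dom := pow_mem Dom.x0Star.2 n
      rw [x0Star_eq, letterStar_pow] at this
      simpa using this
    · have : negX0Star ^ n ∈ Dom := pow_mem Dom.negX0Star.2 n
      rw [negX0Star_eq, letterStar_pow] at this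
      simpa using this
  · have : x1Star ^ l ∈ Dom := pow_mem Dom.x1Star.2 l
    rw [x1Star_eq, letterStar_pow] at this
    simpa using this

theorem toSeries_x0Star : toSeries (AddMonoidAlgebra.single (1, 0) 1) = x0Star := by
  rw [toSeries_single]; simp [starMonomial, letterStar_zero, x0Star_eq]

theorem toSeries_negX0Star : toSeries (AddMonoidAlgebra.single (-1, 0) 1) = negX0Star := by
  rw [toSeries_single]; simp [starMonomial, letterStar_zero, negX0Star_eq]

theorem toSeries_x1Star : toSeries (AddMonoidAlgebra.single (0, 1) 1) = x1Star := by
  rw [toSeries_single]; simp [starMonomial, letterStar_zero, x1Star_eq]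

theorem toSeries_poly (P : NCPoly) : toSeries (AddMonoidAlgebra.single 0 P) = P := by
  rw [toSeries_single]; simp [starMonomial_zero]

theorem toSeries_range : toSeries.range = Dom := by
  apply le_antisymm
  · rintro _ ⟨x, rfl⟩
    show toSeries x ∈ Dom
    rw [toSeries_apply]
    exact sum_mem fun p _ => mul_mem (NCPoly_le_Dom (x.coeff p).2) (starMonomial_mem_Dom _ _)
  · refine Algebra.adjoin_le ?_
    rintro S (hS | rfl | rfl | rfl)
    · exact ⟨_, toSeries_poly ⟨S, hS⟩⟩
    · exact ⟨_, toSeries_x0Star⟩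
    · exact ⟨_, toSeries_negX0Star⟩
    · exact ⟨_, toSeries_x1Star⟩

/-- The domain is the algebra of polynomials in the stars. -/
noncomputable def starPolyEquiv : StarPoly ≃ₐ[ℂ] Dom :=
  (AlgEquiv.ofInjective toSeries toSeries_injective).trans
    (Subalgebra.equivOfEq _ _ toSeries_range)

/-! ### Clearing denominators -/

theorem Dom.x0Star_mul_negX0Star : Dom.x0Star * Dom.negX0Star = 1 := by
  apply Subtype.ext
  show Series.x0Star * Series.negX0Star = 1
  rw [x0Star_eq, negX0Star_eq, letterStar_mul, add_neg_cancel, letterStar_zero]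

/-- The polynomials in `x₀*` with coefficients in `ℂ⟨X⟩`. -/
noncomputable def evalX0Star : Polynomial NCPoly →+* Dom :=
  Polynomial.eval₂RingHom (Subalgebra.inclusion NCPoly_le_Dom : NCPoly →+* Dom) Dom.x0Star

/-- The ideal generated by `x₀* ⧢ x₁* - x₁* + 1`. -/
noncomputable def starIdeal : Ideal Dom :=
  Ideal.span {Dom.x0Star * Dom.x1Star - Dom.x1Star + 1}

/-- Modulo `starIdeal`, the element `S` becomes a polynomial in `x₀*` after multiplication by
powers of `x₀*` and `1 - x₀*`. -/
def IsCleared (S : Dom) : Prop :=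
  ∃ (M N : ℕ) (f : Polynomial NCPoly),
    Dom.x0Star ^ M * (1 - Dom.x0Star) ^ N * S - evalX0Star f ∈ starIdeal

theorem evalX0Star_X : evalX0Star Polynomial.X = Dom.x0Star := Polynomial.eval₂_X _ _

theorem evalX0Star_C (P : NCPoly) :
    evalX0Star (Polynomial.C P) = Subalgebra.inclusion NCPoly_le_Dom P := Polynomial.eval₂_C _ _

theorem IsCleared.add {S T : Dom} (hS : IsCleared S) (hT : IsCleared T) : IsCleared (S + T) := by
  obtain ⟨M, N, f, h⟩ := hS
  obtain ⟨M', N', g, h'⟩ := hT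
  refine ⟨M + M', N + N', Polynomial.X ^ M' * (1 - Polynomial.X) ^ N' * f +
    Polynomial.X ^ M * (1 - Polynomial.X) ^ N * g, ?_⟩
  simp only [map_add, map_mul, map_pow, map_sub, map_one, evalX0Star_X]
  convert add_mem (starIdeal.mul_mem_left (Dom.x0Star ^ M' * (1 - Dom.x0Star) ^ N') h)
    (starIdeal.mul_mem_left (Dom.x0Star ^ M * (1 - Dom.x0Star) ^ N) h') using 1
  ring

theorem IsCleared.mul {S T : Dom} (hS : IsCleared S) (hT : IsCleared T) : IsCleared (S * T) := by
  obtain ⟨M, N, f, h⟩ := hS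
  obtain ⟨M', N', g, h'⟩ := hT
  refine ⟨M + M', N + N', f * g, ?_⟩
  rw [map_mul]
  convert add_mem (starIdeal.mul_mem_left (Dom.x0Star ^ M' * (1 - Dom.x0Star) ^ N' * T) h)
    (starIdeal.mul_mem_left (evalX0Star f) h') using 1
  ring

theorem isCleared_of_eq {M N : ℕ} {S : Dom} {f : Polynomial NCPoly}
    (h : Dom.x0Star ^ M * (1 - Dom.x0Star) ^ N * S = evalX0Star f) : IsCleared S :=
  ⟨M, N, f, by rw [h, sub_self]; exact starIdeal.zero_mem⟩

theorem isCleared_inclusion (P : NCPoly) : IsCleared (Subalgebra.inclusion NCPoly_le_Dom P) :=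
  isCleared_of_eq (M := 0) (N := 0) (f := Polynomial.C P) (by
    rw [evalX0Star_C, pow_zero, pow_zero, one_mul, one_mul])

theorem isCleared_x0Star : IsCleared Dom.x0Star :=
  isCleared_of_eq (M := 0) (N := 0) (f := Polynomial.X) (by
    rw [evalX0Star_X, pow_zero, pow_zero, one_mul, one_mul])

theorem isCleared_negX0Star : IsCleared Dom.negX0Star :=
  isCleared_of_eq (M := 1) (N := 0) (f := 1) (by
    rw [map_one, pow_one, pow_zero, mul_one, Dom.x0Star_mul_negX0Star])

theorem isCleared_x1Star : IsCleared Dom.x1Star := by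
  refine ⟨0, 1, 1, ?_⟩
  rw [map_one, pow_one, pow_zero, one_mul]
  convert starIdeal.neg_mem (Ideal.subset_span rfl) using 1
  ring

theorem isCleared (S : Dom) : IsCleared S := by
  suffices h : ∀ S ∈ Dom, ∃ T : Dom, (T : Series) = S ∧ IsCleared T by
    obtain ⟨T, hT, h⟩ := h S S.2
    rwa [Subtype.ext hT] at h
  intro S hS
  induction hS using Algebra.adjoin_induction with
  | mem S hS =>
    rcases hS with hS | rfl | rfl | rfl
    · exact ⟨_, rfl, isCleared_inclusion ⟨S, hS⟩⟩
    · exact ⟨_, rfl, isCleared_x0Star⟩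
    · exact ⟨_, rfl, isCleared_negX0Star⟩
    · exact ⟨_, rfl, isCleared_x1Star⟩
  | algebraMap c => exact ⟨_, rfl, isCleared_inclusion (algebraMap ℂ NCPoly c)⟩
  | add S T _ _ ihS ihT =>
    obtain ⟨S', rfl, hS⟩ := ihS
    obtain ⟨T', rfl, hT⟩ := ihT
    exact ⟨S' + T', rfl, hS.add hT⟩
  | mul S T _ _ ihS ihT =>
    obtain ⟨S', rfl, hS⟩ := ihS
    obtain ⟨T', rfl, hT⟩ := ihT
    exact ⟨S' * T', rfl, hS.mul hT⟩

theorem mem_starIdeal_of_cleared {M N : ℕ} {S : Dom}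
    (h : Dom.x0Star ^ M * (1 - Dom.x0Star) ^ N * S ∈ starIdeal) : S ∈ starIdeal := by
  rw [← Ideal.Quotient.eq_zero_iff_mem] at h ⊢
  have h0 := congrArg (Ideal.Quotient.mk starIdeal) Dom.x0Star_mul_negX0Star
  have h1 : Ideal.Quotient.mk starIdeal
      (Dom.x0Star * Dom.x1Star - Dom.x1Star + 1) = 0 :=
    Ideal.Quotient.eq_zero_iff_mem.2 (Ideal.subset_span rfl)
  simp only [map_mul, map_pow, map_sub, map_add, map_one] at h h0 h1 ⊢
  have h2 : (1 - Ideal.Quotient.mk starIdeal Dom.x0Star) *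
      Ideal.Quotient.mk starIdeal Dom.x1Star = 1 := by
    linear_combination -h1
  have h3 : IsUnit (Ideal.Quotient.mk starIdeal Dom.x0Star ^ M *
      (1 - Ideal.Quotient.mk starIdeal Dom.x0Star) ^ N) :=
    ((IsUnit.of_mul_eq_one _ h0).pow M).mul ((IsUnit.of_mul_eq_one _ h2).pow N)
  exact (h3.mul_right_eq_zero).1 h

end PolylogExt

namespace PolylogExt
open Series Filter Topology MeasureTheory Set

/-! ### The cleft plane -/

theorem isOpen_Omega : IsOpen Omega := by
  have : IsClosed {z : ℂ | z.im = 0 ∧ (z.re ≤ 0 ∨ 1 ≤ z.re)} :=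
    (isClosed_eq Complex.continuous_im continuous_const).inter
      ((isClosed_le Complex.continuous_re continuous_const).union
        (isClosed_le continuous_const Complex.continuous_re))
  exact this.isOpen_compl

theorem ne_zero_of_mem_Omega {z : ℂ} (hz : z ∈ Omega) : z ≠ 0 := by
  rintro rfl
  exact hz (by simp)

theorem one_sub_mul_ne_zero {z : ℂ} (hz : z ∈ Omega) {t : ℝ} (ht : t ∈ Icc (0 : ℝ) 1) :
    1 - (t : ℂ) * z ≠ 0 := by
  intro h
  have h1 := congrArg Complex.re h
  have h2 := congrArg Complex.im h
  simp at h1 h2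
  obtain ⟨ht0, ht1⟩ := ht
  rcases h2 with rfl | h2
  · simp at h1
  · refine hz ⟨h2, Or.inr ?_⟩
    have hpos : 0 < z.re := by
      by_contra hneg
      nlinarith
    nlinarith

theorem one_sub_ne_zero_of_mem_Omega {z : ℂ} (hz : z ∈ Omega) : 1 - z ≠ 0 := by
  simpa using one_sub_mul_ne_zero hz (t := 1) (by simp)

theorem mul_mem_Omega {z : ℂ} (hz : z ∈ Omega) {t : ℝ} (ht : t ∈ Ioc (0 : ℝ) 1) :
    (t : ℂ) * z ∈ Omega := by
  rintro ⟨h1, h2⟩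
  simp at h1 h2
  obtain ⟨ht0, ht1⟩ := ht
  refine hz ⟨h1.resolve_left ht0.ne', ?_⟩
  rcases h2 with h2 | h2
  · left
    by_contra hneg
    nlinarith
  · right
    have hpos : 0 < z.re := by
      by_contra hneg
      nlinarith
    nlinarith

theorem mem_slitPlane_of_mem_Omega {z : ℂ} (hz : z ∈ Omega) : z ∈ Complex.slitPlane := by
  rw [Complex.mem_slitPlane_iff]
  by_contra h
  simp only [not_or, not_lt, not_not] at h
  exact hz ⟨h.2, Or.inl h.1⟩

/-! ### Growth along the segments issued from the origin -/

/-- `g(tz) = O(t^α)` for `t ∈ ]0, 1]`, locally uniformly in `z ∈ Ω`. -/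
def RayBound (α : ℝ) (g : ℂ → ℂ) : Prop :=
  ∀ z₀ ∈ Omega, ∃ C : ℝ, 0 ≤ C ∧ ∀ᶠ z in 𝓝 z₀, ∀ t ∈ Ioc (0 : ℝ) 1, ‖g (t * z)‖ ≤ C * t ^ α

theorem RayBound.mono {α β : ℝ} {g : ℂ → ℂ} (h : RayBound α g) (hβ : β ≤ α) : RayBound β g := by
  intro z₀ hz₀
  obtain ⟨C, hC, h⟩ := h z₀ hz₀
  refine ⟨C, hC, h.mono fun z hz t ht => (hz t ht).trans ?_⟩
  gcongr ?_ * ?_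
  exact Real.rpow_le_rpow_of_exponent_ge ht.1 ht.2 hβ

theorem RayBound.mul {α β : ℝ} {f g : ℂ → ℂ} (hf : RayBound α f) (hg : RayBound β g) :
    RayBound (α + β) (fun z => f z * g z) := by
  intro z₀ hz₀
  obtain ⟨C, hC, hf⟩ := hf z₀ hz₀
  obtain ⟨D, hD, hg⟩ := hg z₀ hz₀
  refine ⟨C * D, mul_nonneg hC hD, ?_⟩
  filter_upwards [hf, hg] with z h1 h2 t ht
  rw [norm_mul, Real.rpow_add ht.1, mul_mul_mul_comm]
  have := ht.1
  exact mul_le_mul (h1 t ht) (h2 t ht) (norm_nonneg _) (by positivity)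

theorem rayBound_const (c : ℂ) : RayBound 0 (fun _ => c) :=
  fun _ _ => ⟨‖c‖, norm_nonneg c, Eventually.of_forall fun _ _ _ => by simp⟩

theorem RayBound.pow {α : ℝ} {f : ℂ → ℂ} (hf : RayBound α f) (n : ℕ) :
    RayBound (n * α) (fun z => f z ^ n) := by
  induction n with
  | zero => simpa using rayBound_const 1
  | succ n ih =>
    have h := ih.mul hf
    simp only [← pow_succ] at h
    exact h.mono (le_of_eq (by push_cast; ring))

theorem RayBound.sum {ι : Type*} {α : ℝ} (s : Finset ι) {f : ι → ℂ → ℂ}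
    (hf : ∀ i ∈ s, RayBound α (f i)) : RayBound α (fun z => ∑ i ∈ s, f i z) := by
  intro z₀ hz₀
  choose! C hC h using fun i hi => hf i hi z₀ hz₀
  refine ⟨∑ i ∈ s, C i, Finset.sum_nonneg hC, ?_⟩
  filter_upwards [(Finset.eventually_all s).2 h] with z hz t ht
  rw [Finset.sum_mul]
  exact norm_sum_le_of_le s fun i hi => hz i hi t ht

theorem rayBound_id : RayBound 1 (fun z => z) := by
  intro z₀ _
  refine ⟨‖z₀‖ + 1, by positivity, ?_⟩
  filter_upwards [(continuous_norm.tendsto z₀).eventually_le_const (lt_add_one ‖z₀‖)] with z hz t ht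
  rw [norm_mul, Complex.norm_real, Real.norm_of_nonneg ht.1.le, Real.rpow_one, mul_comm]
  gcongr
  exact ht.1.le

theorem rayBound_inv_one_sub : RayBound 0 (fun z => (1 - z)⁻¹) := by
  intro z₀ hz₀
  obtain ⟨r, hr, hball⟩ := Metric.nhds_basis_closedBall.mem_iff.1 (isOpen_Omega.mem_nhds hz₀)
  have hcont : ContinuousOn (fun p : ℝ × ℂ => (1 - (p.1 : ℂ) * p.2)⁻¹)
      (Icc (0 : ℝ) 1 ×ˢ Metric.closedBall z₀ r) := by
    refine ContinuousOn.inv₀ (by fun_prop) ?_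
    rintro ⟨t, z⟩ ⟨ht, hz⟩
    exact one_sub_mul_ne_zero (hball hz) ht
  obtain ⟨C, hC⟩ := (isCompact_Icc.prod (isCompact_closedBall z₀ r)).exists_bound_of_continuousOn
    hcont
  refine ⟨max C 0, le_max_right _ _, ?_⟩
  filter_upwards [Metric.closedBall_mem_nhds z₀ hr] with z hz t ht
  rw [Real.rpow_zero, mul_one]
  exact (hC (t, z) ⟨Ioc_subset_Icc_self ht, hz⟩).trans (le_max_left _ _)

theorem rayBound_log {ε : ℝ} (hε : 0 < ε) : RayBound (-ε) Complex.log := by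
  intro z₀ hz₀
  have hcont : ContinuousAt Complex.log z₀ :=
    (Complex.differentiableAt_log (mem_slitPlane_of_mem_Omega hz₀)).continuousAt
  refine ⟨1 / ε + (‖Complex.log z₀‖ + 1), by positivity, ?_⟩
  filter_upwards [hcont.norm.eventually_le_const (lt_add_one ‖Complex.log z₀‖),
    isOpen_Omega.mem_nhds hz₀] with z hz hzΩ t ht
  rw [Complex.log_ofReal_mul ht.1 (ne_zero_of_mem_Omega hzΩ), add_mul]
  refine (norm_add_le _ _).trans (add_le_add ?_ ?_)
  · rw [Complex.norm_real, Real.norm_eq_abs, Real.rpow_neg ht.1.le, ← div_eq_mul_inv,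
      le_div_iff₀ (Real.rpow_pos_of_pos ht.1 _)]
    have := (Real.abs_log_mul_self_rpow_lt t ε ht.1 ht.2 hε).le
    rwa [abs_mul, abs_of_nonneg (Real.rpow_nonneg ht.1.le _)] at this
  · refine hz.trans (le_mul_of_one_le_right (by positivity) ?_)
    exact Real.one_le_rpow_of_pos_of_le_one_of_nonpos ht.1 ht.2 (by linarith)

theorem rayBound_log_pow (n : ℕ) : RayBound (-1 / 4) (fun z => Complex.log z ^ n) := by
  rcases n.eq_zero_or_pos with rfl | hn
  · simpa using (rayBound_const 1).mono (by norm_num)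
  · have hn' : (0 : ℝ) < n := by exact_mod_cast hn
    have h := (rayBound_log (ε := 1 / (4 * n)) (by positivity)).pow n
    refine h.mono (le_of_eq ?_)
    field_simp

theorem RayBound.tendsto {α : ℝ} {g : ℂ → ℂ} (h : RayBound α g) (hα : 0 < α) {z : ℂ}
    (hz : z ∈ Omega) : Tendsto (fun t : ℝ => g (t * z)) (𝓝[>] 0) (𝓝 0) := by
  obtain ⟨C, -, h⟩ := h z hz
  refine squeeze_zero_norm' (a := fun t : ℝ => C * t ^ α) ?_ ?_
  · filter_upwards [Ioc_mem_nhdsGT (zero_lt_one (α := ℝ))] with t ht using h.self_of_nhds t ht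
  · have : Tendsto (fun t : ℝ => C * t ^ α) (𝓝 0) (𝓝 (C * 0 ^ α)) :=
      ((Real.continuousAt_rpow_const 0 α (Or.inr hα.le)).tendsto).const_mul C
    rw [Real.zero_rpow hα.ne', mul_zero] at this
    exact this.mono_left nhdsWithin_le_nhds

/-! ### Primitives along the segments -/

/-- The integral of `g(s) ds/s` along the segment from `0` to `z`. -/
noncomputable def rayIntegral (g : ℂ → ℂ) (z : ℂ) : ℂ := ∫ t in (0 : ℝ)..1, g (t * z) / t

theorem intervalIntegrable_rpow_neg_half (C : ℝ) :
    IntervalIntegrable (fun t : ℝ => C * t ^ (-(1 / 2) : ℝ)) volume 0 1 :=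
  (intervalIntegral.intervalIntegrable_rpow' (by norm_num)).const_mul C

theorem norm_div_le_of_le {C t : ℝ} (ht : 0 < t) {a : ℂ} (h : ‖a‖ ≤ C * t ^ (1 / 2 : ℝ)) :
    ‖a / t‖ ≤ C * t ^ (-(1 / 2) : ℝ) := by
  rw [norm_div, Complex.norm_real, Real.norm_of_nonneg ht.le, div_le_iff₀ ht]
  refine h.trans (le_of_eq ?_)
  have h1 : t ^ (1 / 2 : ℝ) = t ^ (-(1 / 2) : ℝ) * t := by
    conv_rhs => rw [← Real.rpow_one t, ← Real.rpow_mul ht.le, ← Real.rpow_add ht]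
    norm_num
  rw [h1, mul_assoc]

theorem RayBound.rayIntegral {g : ℂ → ℂ} (h : RayBound (1 / 2) g) :
    RayBound (1 / 2) (rayIntegral g) := by
  intro z₀ hz₀
  obtain ⟨C, hC, h⟩ := h z₀ hz₀
  set K : ℝ := ∫ s in (0 : ℝ)..1, s ^ (-(1 / 2) : ℝ) with hK
  have hK0 : 0 ≤ K := intervalIntegral.integral_nonneg zero_le_one fun s hs =>
    Real.rpow_nonneg hs.1 _
  refine ⟨C * K, mul_nonneg hC hK0, ?_⟩
  filter_upwards [h] with z hz t ht
  have key : ‖PolylogExt.rayIntegral g (t * z)‖ ≤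
      ∫ s in (0 : ℝ)..1, (C * t ^ (1 / 2 : ℝ)) * s ^ (-(1 / 2) : ℝ) := by
    refine intervalIntegral.norm_integral_le_of_norm_le zero_le_one
      (Eventually.of_forall fun s hs => ?_) (intervalIntegrable_rpow_neg_half _)
    refine norm_div_le_of_le hs.1 ?_
    have hst : s * t ∈ Ioc (0 : ℝ) 1 :=
      ⟨mul_pos hs.1 ht.1, mul_le_one₀ hs.2 ht.1.le ht.2⟩
    have := hz (s * t) hst
    rw [Real.mul_rpow hs.1.le ht.1.le, Complex.ofReal_mul, mul_assoc] at this
    linarith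
  rw [intervalIntegral.integral_const_mul, ← hK] at key
  linarith

theorem hasDerivAt_comp_ray {g : ℂ → ℂ} (hg : DifferentiableOn ℂ g Omega) {z : ℂ}
    (hz : z ∈ Omega) {t : ℝ} (ht : t ∈ Ioc (0 : ℝ) 1) :
    HasDerivAt (fun w : ℂ => g (t * w)) (deriv g (t * z) * t) z := by
  have h1 := (hg.differentiableAt (isOpen_Omega.mem_nhds (mul_mem_Omega hz ht))).hasDerivAt
  have h2 : HasDerivAt (fun w : ℂ => (t : ℂ) * w) t z := by
    simpa using (hasDerivAt_id z).const_mul (t : ℂ)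
  exact h1.comp z h2

theorem hasDerivAt_ray {g : ℂ → ℂ} (hg : DifferentiableOn ℂ g Omega) {z : ℂ}
    (hz : z ∈ Omega) {t : ℝ} (ht : t ∈ Ioc (0 : ℝ) 1) :
    HasDerivAt (fun s : ℝ => g (s * z)) (deriv g (t * z) * z) t := by
  have h1 := (hg.differentiableAt (isOpen_Omega.mem_nhds (mul_mem_Omega hz ht))).hasDerivAt
  have h2 : HasDerivAt (fun w : ℂ => w * z) z (t : ℂ) := by
    simpa using (hasDerivAt_id (t : ℂ)).mul_const z
  exact (h1.comp (t : ℂ) h2).comp_ofReal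

theorem norm_deriv_ray_le {g : ℂ → ℂ} (hg : DifferentiableOn ℂ g Omega) {z : ℂ} {r C t : ℝ}
    (hr : 0 < r) (hball : Metric.closedBall z r ⊆ Omega) (ht : t ∈ Ioc (0 : ℝ) 1)
    (hC : ∀ w ∈ Metric.closedBall z r, ‖g (t * w)‖ ≤ C * t ^ (1 / 2 : ℝ)) :
    ‖deriv g (t * z)‖ ≤ C / r * t ^ (-(1 / 2) : ℝ) := by
  have hd : DifferentiableOn ℂ (fun w : ℂ => g (t * w)) (Metric.closedBall z r) := fun w hw =>
    (hasDerivAt_comp_ray hg (hball hw) ht).differentiableAt.differentiableWithinAt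
  have h := Complex.norm_deriv_le_of_forall_mem_sphere_norm_le hr
    (hd.mono Metric.closure_ball_subset_closedBall).diffContOnCl
    fun w hw => hC w (Metric.sphere_subset_closedBall hw)
  rw [(hasDerivAt_comp_ray hg (hball (Metric.mem_closedBall_self hr.le)) ht).deriv] at h
  have h2 : ‖deriv g (t * z) * t‖ ≤ C / r * t ^ (1 / 2 : ℝ) := by
    refine h.trans (le_of_eq ?_)
    ring
  have := norm_div_le_of_le ht.1 h2
  rwa [mul_div_cancel_right₀ _ (by exact_mod_cast ht.1.ne')] at this

theorem hasDerivAt_rayIntegral {g : ℂ → ℂ} (hg : DifferentiableOn ℂ g Omega)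
    (hb : RayBound (1 / 2) g) {z₀ : ℂ} (hz₀ : z₀ ∈ Omega) :
    HasDerivAt (rayIntegral g) (g z₀ / z₀) z₀ := by
  obtain ⟨C, hC, h⟩ := hb z₀ hz₀
  obtain ⟨R, hR, hball⟩ := Metric.eventually_nhds_iff_ball.1
    (h.and (isOpen_Omega.eventually_mem hz₀))
  have hRΩ : ∀ z ∈ Metric.ball z₀ R, z ∈ Omega := fun z hz => (hball z hz).2
  have hsub : ∀ z ∈ Metric.ball z₀ (R / 2), Metric.closedBall z (R / 4) ⊆ Metric.ball z₀ R := by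
    intro z hz
    refine Metric.closedBall_subset_ball' ?_
    rw [Metric.mem_ball] at hz
    linarith
  have hsmall : Metric.ball z₀ (R / 2) ⊆ Metric.ball z₀ R := Metric.ball_subset_ball (by linarith)
  have hmaps : ∀ z ∈ Omega, MapsTo (fun t : ℝ => (t : ℂ) * z) (Ioc 0 1) Omega :=
    fun z hz t ht => mul_mem_Omega hz ht
  have hcont : ∀ z : ℂ, ContinuousOn (fun t : ℝ => (t : ℂ) * z) (Ioc 0 1) := fun z => by fun_prop
  have hmeas : ∀ z ∈ Omega, AEStronglyMeasurable (fun t : ℝ => g (t * z) / t)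
      (volume.restrict (uIoc 0 1)) := by
    intro z hz
    rw [uIoc_of_le zero_le_one]
    refine ContinuousOn.aestronglyMeasurable ?_ measurableSet_Ioc
    refine (hg.continuousOn.comp (hcont z) (hmaps z hz)).div (by fun_prop) ?_
    intro t ht
    exact_mod_cast ht.1.ne'
  have hmeas' : AEStronglyMeasurable (fun t : ℝ => deriv g (t * z₀))
      (volume.restrict (uIoc 0 1)) := by
    rw [uIoc_of_le zero_le_one]
    exact ContinuousOn.aestronglyMeasurable
      ((hg.deriv isOpen_Omega).continuousOn.comp (hcont z₀) (hmaps z₀ hz₀)) measurableSet_Ioc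
  obtain ⟨hint, hder⟩ := intervalIntegral.hasDerivAt_integral_of_dominated_loc_of_deriv_le
    (F := fun (z : ℂ) (t : ℝ) => g (t * z) / t) (F' := fun (z : ℂ) (t : ℝ) => deriv g (t * z))
    (x₀ := z₀) (a := 0) (b := 1) (μ := volume)
    (bound := fun t : ℝ => C / (R / 4) * t ^ (-(1 / 2) : ℝ))
    (Metric.ball_mem_nhds z₀ (by linarith : 0 < R / 2))
    ((isOpen_Omega.eventually_mem hz₀).mono hmeas)
    (by
      refine (intervalIntegrable_rpow_neg_half C).mono_fun' (hmeas z₀ hz₀) ?_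
      rw [uIoc_of_le zero_le_one]
      refine (ae_restrict_iff' measurableSet_Ioc).2 (Eventually.of_forall fun t ht => ?_)
      exact norm_div_le_of_le ht.1 (h.self_of_nhds t ht))
    hmeas'
    (Eventually.of_forall fun t ht z hz => by
      rw [uIoc_of_le zero_le_one] at ht
      exact norm_deriv_ray_le hg (by linarith) (fun w hw => hRΩ w (hsub z hz hw)) ht
        fun w hw => (hball w (hsub z hz hw)).1 t ht)
    (intervalIntegrable_rpow_neg_half _)
    (Eventually.of_forall fun t ht z hz => by
      rw [uIoc_of_le zero_le_one] at ht
      have ht0 : (t : ℂ) ≠ 0 := by exact_mod_cast ht.1.ne'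
      have := (hasDerivAt_comp_ray hg (hRΩ z (hsmall hz)) ht).div_const (t : ℂ)
      rwa [mul_div_cancel_right₀ _ ht0] at this)
  refine hder.congr_deriv ?_
  have hz0 := ne_zero_of_mem_Omega hz₀
  have hray : ∀ t ∈ Ioc (0 : ℝ) 1,
      HasDerivAt (fun s : ℝ => g (s * z₀) / z₀) (deriv g (t * z₀)) t := by
    intro t ht
    have := (hasDerivAt_ray hg hz₀ ht).div_const z₀
    rwa [mul_div_cancel_right₀ _ hz0] at this
  have hlim0 : Tendsto (fun s : ℝ => g (s * z₀) / z₀) (𝓝[>] 0) (𝓝 0) := by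
    simpa using (hb.tendsto (by norm_num) hz₀).div_const z₀
  have hlim1 : Tendsto (fun s : ℝ => g (s * z₀) / z₀) (𝓝[<] 1) (𝓝 (g z₀ / z₀)) := by
    have := (hray 1 (by simp)).continuousAt.tendsto
    simp only [Complex.ofReal_one, one_mul] at this
    exact this.mono_left nhdsWithin_le_nhds
  rw [intervalIntegral.integral_eq_sub_of_hasDerivAt_of_tendsto zero_lt_one
    (fun t ht => hray t (Ioo_subset_Ioc_self ht)) hint hlim0 hlim1, sub_zero]

/-! ### Polylogarithms -/

theorem Li_nil : Li [] = fun _ => 1 := by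
  ext z; rw [Li]

theorem Li_of_notMem {w : List Letter} (hw : Letter.x1 ∉ w) :
    Li w = fun z => Complex.log z ^ w.length / (w.length.factorial : ℂ) := by
  ext z
  rcases w with _ | ⟨_ | _, w⟩
  · simp [Li]
  · simp only [List.mem_cons, reduceCtorEq, false_or] at hw
    rw [Li, if_neg hw, List.length_cons]
  · simp at hw

theorem Li_x0_cons {w : List Letter} (hw : Letter.x1 ∈ w) :
    Li (Letter.x0 :: w) = rayIntegral (Li w) := by
  ext z
  rw [Li, if_pos hw]; rfl

theorem Li_x1_cons (w : List Letter) :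
    Li (Letter.x1 :: w) = rayIntegral (fun z => z * (1 - z)⁻¹ * Li w z) := by
  ext z
  rw [Li]
  refine intervalIntegral.integral_congr_ae (Eventually.of_forall fun t ht => ?_)
  rw [uIoc_of_le zero_le_one] at ht
  have ht0 : (t : ℂ) ≠ 0 := by exact_mod_cast ht.1.ne'
  field_simp

theorem differentiableOn_Li_and_rayBound (w : List Letter) :
    DifferentiableOn ℂ (Li w) Omega ∧ RayBound (-1 / 4) (Li w) ∧
      (Letter.x1 ∈ w → RayBound (1 / 2) (Li w)) := by
  induction w with
  | nil =>
    rw [Li_nil]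
    exact ⟨differentiableOn_const 1, (rayBound_const 1).mono (by norm_num), by simp⟩
  | cons a w ih =>
    obtain ⟨hd, hb, hb1⟩ := ih
    cases a with
    | x0 =>
      by_cases hw : Letter.x1 ∈ w
      · rw [Li_x0_cons hw]
        have hb' := (hb1 hw).rayIntegral
        exact ⟨fun z hz => (hasDerivAt_rayIntegral hd (hb1 hw)
          hz).differentiableAt.differentiableWithinAt, hb'.mono (by norm_num), fun _ => hb'⟩
      · have hw' : Letter.x1 ∉ Letter.x0 :: w := by simpa using hw
        rw [Li_of_notMem hw']
        refine ⟨?_, ?_, fun h => absurd h hw'⟩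
        · refine DifferentiableOn.div_const (DifferentiableOn.pow (fun z hz => ?_) _) _
          exact (Complex.differentiableAt_log
            (mem_slitPlane_of_mem_Omega hz)).differentiableWithinAt
        · simp only [div_eq_mul_inv (Complex.log _ ^ _)]
          refine ((rayBound_log_pow _).mul (rayBound_const _)).mono (by norm_num)
    | x1 =>
      rw [Li_x1_cons]
      have hbg : RayBound (1 / 2) (fun z => z * (1 - z)⁻¹ * Li w z) :=
        ((rayBound_id.mul rayBound_inv_one_sub).mul hb).mono (by norm_num)
      have hdg : DifferentiableOn ℂ (fun z => z * (1 - z)⁻¹ * Li w z) Omega := by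
        refine DifferentiableOn.mul (DifferentiableOn.mul differentiableOn_id ?_) hd
        exact DifferentiableOn.inv (by fun_prop) fun z hz => one_sub_ne_zero_of_mem_Omega hz
      exact ⟨fun z hz => (hasDerivAt_rayIntegral hdg hbg
        hz).differentiableAt.differentiableWithinAt, hbg.rayIntegral.mono (by norm_num),
        fun _ => hbg.rayIntegral⟩

theorem differentiableOn_Li (w : List Letter) : DifferentiableOn ℂ (Li w) Omega :=
  (differentiableOn_Li_and_rayBound w).1

theorem rayBound_Li (w : List Letter) : RayBound (-1 / 4) (Li w) :=
  (differentiableOn_Li_and_rayBound w).2.1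

theorem rayBound_Li_of_mem {w : List Letter} (hw : Letter.x1 ∈ w) : RayBound (1 / 2) (Li w) :=
  (differentiableOn_Li_and_rayBound w).2.2 hw

theorem hasDerivAt_Li_x0_cons (w : List Letter) {z : ℂ} (hz : z ∈ Omega) :
    HasDerivAt (Li (Letter.x0 :: w)) (Li w z / z) z := by
  by_cases hw : Letter.x1 ∈ w
  · rw [Li_x0_cons hw]
    exact hasDerivAt_rayIntegral (differentiableOn_Li w) (rayBound_Li_of_mem hw) hz
  · rw [Li_of_notMem hw, Li_of_notMem (by simpa using hw)]
    have h := ((Complex.hasDerivAt_log (mem_slitPlane_of_mem_Omega hz)).pow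
      (w.length + 1)).div_const ((w.length + 1).factorial : ℂ)
    refine h.congr_deriv ?_
    have h1 : ((w.length + 1 : ℕ) : ℂ) ≠ 0 := Nat.cast_ne_zero.2 (Nat.succ_ne_zero _)
    have h2 : (w.length.factorial : ℂ) ≠ 0 := Nat.cast_ne_zero.2 (Nat.factorial_ne_zero _)
    have h3 := ne_zero_of_mem_Omega hz
    rw [Nat.factorial_succ, Nat.cast_mul, Nat.add_sub_cancel]
    field_simp

theorem hasDerivAt_Li_x1_cons (w : List Letter) {z : ℂ} (hz : z ∈ Omega) :
    HasDerivAt (Li (Letter.x1 :: w)) (Li w z / (1 - z)) z := by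
  rw [Li_x1_cons]
  have hbg : RayBound (1 / 2) (fun z => z * (1 - z)⁻¹ * Li w z) :=
    ((rayBound_id.mul rayBound_inv_one_sub).mul (rayBound_Li w)).mono (by norm_num)
  have hdg : DifferentiableOn ℂ (fun z => z * (1 - z)⁻¹ * Li w z) Omega := by
    refine DifferentiableOn.mul (DifferentiableOn.mul differentiableOn_id ?_)
      (differentiableOn_Li w)
    exact DifferentiableOn.inv (by fun_prop) fun z hz => one_sub_ne_zero_of_mem_Omega hz
  refine (hasDerivAt_rayIntegral hdg hbg hz).congr_deriv ?_
  have h3 := ne_zero_of_mem_Omega hz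
  have h4 := one_sub_ne_zero_of_mem_Omega hz
  field_simp

end PolylogExt

namespace PolylogExt
open Series Filter Topology MeasureTheory Set

/-! ### Polylogarithms of noncommutative polynomials -/

/-- The linear extension of `w ↦ Li_w` to noncommutative polynomials. -/
noncomputable def evalLi (S : Series) (z : ℂ) : ℂ := ∑ᶠ w, S w * Li w z

theorem evalLi_eq_sum {N : ℕ} {S : Series} (h : LengthLT N S) (z : ℂ) :
    evalLi S z = ∑ w ∈ wordsLT N, S w * Li w z := by
  refine finsum_eq_sum_of_support_subset _ fun w hw => ?_
  rw [Finset.mem_coe, mem_wordsLT]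
  by_contra hlt
  rw [Function.mem_support, h w (not_lt.1 hlt), zero_mul] at hw
  exact hw rfl

theorem evalLi_add {S T : Series} (hS : S ∈ NCPoly) (hT : T ∈ NCPoly) (z : ℂ) :
    evalLi (S + T) z = evalLi S z + evalLi T z := by
  obtain ⟨N, hN⟩ := mem_NCPoly_iff.1 hS
  obtain ⟨M, hM⟩ := mem_NCPoly_iff.1 hT
  have hN := hN.mono (le_max_left N M)
  have hM := hM.mono (le_max_right N M)
  rw [evalLi_eq_sum hN, evalLi_eq_sum hM, evalLi_eq_sum (hN.add hM), ← Finset.sum_add_distrib]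
  exact Finset.sum_congr rfl fun w _ => by rw [add_apply, add_mul]

theorem evalLi_smul {S : Series} (hS : S ∈ NCPoly) (c z : ℂ) :
    evalLi (c • S) z = c * evalLi S z := by
  obtain ⟨N, hN⟩ := mem_NCPoly_iff.1 hS
  rw [evalLi_eq_sum hN, evalLi_eq_sum (hN.smul c), Finset.mul_sum]
  exact Finset.sum_congr rfl fun w _ => by rw [smul_apply, mul_assoc]

theorem evalLi_zero (z : ℂ) : evalLi 0 z = 0 := by
  simp [evalLi]

theorem evalLi_sum_smul {ι : Type*} (s : Finset ι) (c : ι → ℂ) (S : ι → Series)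
    (hS : ∀ i, S i ∈ NCPoly) (z : ℂ) :
    evalLi (∑ i ∈ s, c i • S i) z = ∑ i ∈ s, c i * evalLi (S i) z := by
  induction s using Finset.cons_induction with
  | empty => simp [evalLi_zero]
  | cons i s hi ih =>
    rw [Finset.sum_cons, Finset.sum_cons, evalLi_add (NCPoly.smul_mem (hS i) _)
      (sum_mem fun j _ => NCPoly.smul_mem (hS j) _), ih, evalLi_smul (hS i)]

theorem word_mem_NCPoly (w : List Letter) : word w ∈ NCPoly := word_mem_polynomials w

theorem residual_mem_NCPoly {S : Series} (hS : S ∈ NCPoly) (a : Letter) :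
    residual a S ∈ NCPoly := by
  obtain ⟨N, hN⟩ := mem_NCPoly_iff.1 hS
  exact mem_NCPoly_iff.2 ⟨N, (hN.mono N.le_succ).residual a⟩

theorem evalLi_word (w : List Letter) (z : ℂ) : evalLi (word w) z = Li w z := by
  rw [evalLi, finsum_eq_single _ w]
  · simp [word]
  · intro v hv
    simp [word, hv]

theorem hasDerivAt_evalLi {S : Series} (hS : S ∈ NCPoly) {z : ℂ} (hz : z ∈ Omega) :
    HasDerivAt (evalLi S)
      (evalLi (residual Letter.x0 S) z / z + evalLi (residual Letter.x1 S) z / (1 - z)) z := by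
  obtain ⟨N, hN⟩ := mem_NCPoly_iff.1 hS
  have hN := hN.mono N.le_succ
  have h : evalLi S = fun z => S [] * Li [] z +
      (∑ w ∈ wordsLT N, S (Letter.x0 :: w) * Li (Letter.x0 :: w) z +
        ∑ w ∈ wordsLT N, S (Letter.x1 :: w) * Li (Letter.x1 :: w) z) := by
    ext z
    rw [evalLi_eq_sum hN, sum_wordsLT_succ]
  rw [h, evalLi_eq_sum (hN.residual _), evalLi_eq_sum (hN.residual _), Finset.sum_div,
    Finset.sum_div, Li_nil]
  simp only [residual_apply, mul_div_assoc]
  refine HasDerivAt.const_add _ (HasDerivAt.add ?_ ?_)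
  · exact HasDerivAt.fun_sum fun w _ => (hasDerivAt_Li_x0_cons w hz).const_mul _
  · exact HasDerivAt.fun_sum fun w _ => (hasDerivAt_Li_x1_cons w hz).const_mul _

/-! ### The shuffle relations -/

theorem eq_zero_of_hasDerivAt_zero {E : ℂ → ℂ} (hE : ∀ z ∈ Omega, HasDerivAt E 0 z) {z : ℂ}
    (hz : z ∈ Omega) (hlim : Tendsto (fun t : ℝ => E (t * z)) (𝓝[>] 0) (𝓝 0)) : E z = 0 := by
  have hd : DifferentiableOn ℂ E Omega := fun z hz =>
    (hE z hz).differentiableAt.differentiableWithinAt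
  have hray : ∀ t ∈ Ioc (0 : ℝ) 1, HasDerivAt (fun s : ℝ => E (s * z)) 0 t := by
    intro t ht
    have := hasDerivAt_ray hd hz ht
    rwa [(hE _ (mul_mem_Omega hz ht)).deriv, zero_mul] at this
  have hlim1 : Tendsto (fun s : ℝ => E (s * z)) (𝓝[<] 1) (𝓝 (E z)) := by
    have := (hray 1 (by simp)).continuousAt.tendsto
    simp only [Complex.ofReal_one, one_mul] at this
    exact this.mono_left nhdsWithin_le_nhds
  have := intervalIntegral.integral_eq_sub_of_hasDerivAt_of_tendsto zero_lt_one
    (fun t ht => hray t (Ioo_subset_Ioc_self ht)) (by simp) hlim hlim1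
  simpa using this.symm

theorem mul_apply_eq_zero_of_notMem {w : List Letter} (hw : Letter.x1 ∉ w) :
    ∀ {S : Series} (T : Series), (∀ v : List Letter, Letter.x1 ∉ v → S v = 0) → (S * T) w = 0 := by
  induction w with
  | nil =>
    intro S T hS
    rw [mul_nil, hS [] hw, zero_mul]
  | cons a w ih =>
    intro S T hS
    simp only [List.mem_cons, not_or] at hw
    rw [mul_cons, ih hw.2 (residual a T) hS,
      ih hw.2 T fun v hv => hS (a :: v) (by simp [hw.1, hv]), add_zero]

theorem word_replicate_mul (a : Letter) (m n : ℕ) :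
    word (List.replicate m a) * word (List.replicate n a) =
      ((m + n).choose m : ℂ) • word (List.replicate (m + n) a) := by
  induction m generalizing n with
  | zero =>
    show 1 * word (List.replicate n a) = _
    simp
  | succ m ihm =>
    induction n with
    | zero =>
      show word (List.replicate (m + 1) a) * 1 = _
      simp
    | succ n ihn =>
      refine ext_residual ?_ fun b => ?_
      · simp [word, List.replicate_succ, ← add_assoc]
      · rw [residual_mul, residual_smul, ← add_assoc, List.replicate_succ (n := m),
          List.replicate_succ (n := n), List.replicate_succ (n := m + 1 + n),
          residual_word_cons, residual_word_cons, residual_word_cons]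
        split_ifs with h
        · rw [← List.replicate_succ, ← List.replicate_succ, ihm, ihn,
            show m + (n + 1) = m + 1 + n by ring, ← add_smul, Nat.choose_succ_succ]
          push_cast
          rfl
        · simp

theorem tendsto_evalLi {S : Series} (hS : S ∈ NCPoly)
    (h1 : ∀ v : List Letter, Letter.x1 ∉ v → S v = 0) {z : ℂ} (hz : z ∈ Omega) :
    Tendsto (fun t : ℝ => evalLi S (t * z)) (𝓝[>] 0) (𝓝 0) := by
  obtain ⟨N, hN⟩ := mem_NCPoly_iff.1 hS
  refine RayBound.tendsto (α := 1 / 2) ?_ (by norm_num) hz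
  simp only [funext (evalLi_eq_sum hN)]
  refine RayBound.sum _ fun w _ => ?_
  by_cases hw : Letter.x1 ∈ w
  · exact ((rayBound_const _).mul (rayBound_Li_of_mem hw)).mono (by norm_num)
  · simp only [h1 w hw, zero_mul]
    have := (rayBound_const 0).mul ((rayBound_log_pow 0).mul rayBound_id)
    simp only [zero_mul] at this
    exact this.mono (by norm_num)

theorem evalLi_word_mul_of_notMem {u v : List Letter} (hu : Letter.x1 ∉ u) (hv : Letter.x1 ∉ v)
    (z : ℂ) : evalLi (word u * word v) z = evalLi (word u) z * evalLi (word v) z := by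
  have hrep : ∀ w : List Letter, Letter.x1 ∉ w → w = List.replicate w.length Letter.x0 := by
    intro w hw
    refine List.eq_replicate_of_mem fun b hb => ?_
    cases b
    · rfl
    · exact absurd hb hw
  have huv : Letter.x1 ∉ List.replicate (u.length + v.length) Letter.x0 := by simp
  conv_lhs => rw [hrep u hu, hrep v hv, word_replicate_mul]
  rw [evalLi_smul (word_mem_NCPoly _), evalLi_word, evalLi_word, evalLi_word, Li_of_notMem hu,
    Li_of_notMem hv, Li_of_notMem huv, List.length_replicate]
  have h := Nat.add_choose_mul_factorial_mul_factorial u.length v.length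
  rw [← Nat.choose_symm_add] at h
  have h2 : (u.length.factorial : ℂ) ≠ 0 := Nat.cast_ne_zero.2 (Nat.factorial_ne_zero _)
  have h3 : (v.length.factorial : ℂ) ≠ 0 := Nat.cast_ne_zero.2 (Nat.factorial_ne_zero _)
  have h4 : ((u.length + v.length).factorial : ℂ) ≠ 0 :=
    Nat.cast_ne_zero.2 (Nat.factorial_ne_zero _)
  have h5 := congrArg (Nat.cast (R := ℂ)) h
  push_cast at h5
  field_simp
  rw [← h5, pow_add]
  ring

theorem evalLi_word_mul (n : ℕ) : ∀ u v : List Letter, u.length + v.length ≤ n → ∀ z ∈ Omega,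
    evalLi (word u * word v) z = evalLi (word u) z * evalLi (word v) z := by
  induction n with
  | zero =>
    intro u v h z _
    exact evalLi_word_mul_of_notMem (by rw [List.length_eq_zero_iff.1 (by omega : u.length = 0)]; simp)
      (by rw [List.length_eq_zero_iff.1 (by omega : v.length = 0)]; simp) z
  | succ n ih =>
    have hres : ∀ u v : List Letter, u.length + v.length ≤ n + 1 → ∀ a : Letter, ∀ z ∈ Omega,
        evalLi (residual a (word u) * word v) z =
          evalLi (residual a (word u)) z * evalLi (word v) z := by
      intro u v h a z hz
      rcases u with _ | ⟨b, u⟩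
      · rw [show word [] = 1 from rfl, residual_one, zero_mul, evalLi_zero, zero_mul]
      · rw [residual_word_cons]
        split_ifs
        · exact ih u v (by simp at h; omega) z hz
        · rw [zero_mul, evalLi_zero, zero_mul]
    have hmem : ∀ u v : List Letter, word u * word v ∈ NCPoly := fun u v =>
      mul_mem (word_mem_NCPoly u) (word_mem_NCPoly v)
    have hder : ∀ u v : List Letter, u.length + v.length ≤ n + 1 → ∀ z ∈ Omega,
        HasDerivAt (fun z => evalLi (word u * word v) z - evalLi (word u) z * evalLi (word v) z)
          0 z := by
      intro u v h z hz
      refine ((hasDerivAt_evalLi (hmem u v) hz).sub ((hasDerivAt_evalLi (word_mem_NCPoly u) hz).mul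
        (hasDerivAt_evalLi (word_mem_NCPoly v) hz))).congr_deriv ?_
      have hm : ∀ (a : Letter) (u v : List Letter), residual a (word u) * word v ∈ NCPoly :=
        fun a u v => mul_mem (residual_mem_NCPoly (word_mem_NCPoly u) a) (word_mem_NCPoly v)
      simp only [residual_mul]
      rw [mul_comm (word u), mul_comm (word u), evalLi_add (hm _ _ _) (hm _ _ _),
        evalLi_add (hm _ _ _) (hm _ _ _), hres u v h _ z hz, hres u v h _ z hz,
        hres v u (by omega) _ z hz, hres v u (by omega) _ z hz]
      ring
    have hcase : ∀ u v : List Letter, u.length + v.length ≤ n + 1 → Letter.x1 ∈ u → ∀ z ∈ Omega,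
        evalLi (word u * word v) z = evalLi (word u) z * evalLi (word v) z := by
      intro u v h hu z hz
      have hwu : ∀ w : List Letter, Letter.x1 ∉ w → word u w = 0 := by
        intro w hw
        refine if_neg ?_
        rintro rfl
        exact hw hu
      refine sub_eq_zero.1 (eq_zero_of_hasDerivAt_zero (hder u v h) hz ?_)
      have h1 := tendsto_evalLi (hmem u v)
        (fun w hw => mul_apply_eq_zero_of_notMem hw (word v) hwu) hz
      have h2 := ((rayBound_Li_of_mem hu).mul (rayBound_Li v)).tendsto (by norm_num) hz
      simp only [evalLi_word]
      simpa using h1.sub h2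
    intro u v h z hz
    by_cases hu : Letter.x1 ∈ u
    · exact hcase u v h hu z hz
    by_cases hv : Letter.x1 ∈ v
    · rw [mul_comm, hcase v u (by omega) hv z hz, mul_comm]
    exact evalLi_word_mul_of_notMem hu hv z

theorem evalLi_mul {S T : Series} (hS : S ∈ NCPoly) (hT : T ∈ NCPoly) {z : ℂ} (hz : z ∈ Omega) :
    evalLi (S * T) z = evalLi S z * evalLi T z := by
  have key : ∀ {S T : Series}, S ∈ NCPoly → T ∈ NCPoly →
      (∀ u, evalLi (word u * T) z = evalLi (word u) z * evalLi T z) →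
      evalLi (S * T) z = evalLi S z * evalLi T z := by
    intro S T hS hT h
    obtain ⟨N, hN⟩ := mem_NCPoly_iff.1 hS
    rw [hN.eq_sum, Finset.sum_mul]
    simp only [smul_mul_assoc]
    rw [evalLi_sum_smul _ _ _ fun w => mul_mem (word_mem_NCPoly w) hT,
      evalLi_sum_smul _ _ _ word_mem_NCPoly, Finset.sum_mul]
    exact Finset.sum_congr rfl fun w _ => by rw [h, mul_assoc]
  refine key hS hT fun u => ?_
  rw [mul_comm, mul_comm (evalLi (word u) z)]
  refine key hT (word_mem_NCPoly u) fun v => ?_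
  exact evalLi_word_mul _ v u le_rfl z hz

/-- The morphism `P ↦ Li_P` from the shuffle algebra of noncommutative polynomials to the
functions on `Ω`. -/
noncomputable def liHom : NCPoly →ₐ[ℂ] (Omega → ℂ) where
  toFun P z := evalLi P z
  map_one' := by
    ext z
    exact (evalLi_word [] z).trans (by rw [Li_nil]; rfl)
  map_mul' P Q := by
    ext z
    exact evalLi_mul P.2 Q.2 z.2
  map_zero' := by
    ext z
    exact evalLi_zero z
  map_add' P Q := by
    ext z
    exact evalLi_add P.2 Q.2 z
  commutes' c := by
    ext z
    have h : ((algebraMap ℂ NCPoly c : NCPoly) : Series) = c • word [] :=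
      Algebra.algebraMap_eq_smul_one c
    show evalLi ((algebraMap ℂ NCPoly c : NCPoly) : Series) z = c
    rw [h, evalLi_smul (word_mem_NCPoly _), evalLi_word, Li_nil, mul_one]

theorem liHom_apply (P : NCPoly) (z : Omega) : liHom P z = evalLi P z := rfl

theorem liHom_mem_Hol (P : NCPoly) : liHom P ∈ Hol :=
  ⟨evalLi P, fun _ hz => (hasDerivAt_evalLi P.2 hz).differentiableAt.differentiableWithinAt,
    fun _ => rfl⟩

end PolylogExt

namespace PolylogExt
open Series Filter Topology Polynomial

/-! ### Wronskians of polynomials -/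

theorem exists_sub_C_mul_wronskian {p q : ℂ[X]} (hp : p ≠ 0) (hq : q ≠ 0) (a : ℂ) :
    ∃ E : ℂ[X], (X - C a) * (q * derivative p - derivative q * p) =
        (X - C a) ^ (rootMultiplicity a q + rootMultiplicity a p) * E ∧
      (rootMultiplicity a q = rootMultiplicity a p → E.eval a = 0) ∧
      (rootMultiplicity a q ≠ rootMultiplicity a p → E.eval a ≠ 0) := by
  obtain ⟨p₁, hp₁, hpa⟩ := exists_eq_pow_rootMultiplicity_mul_and_not_dvd p hp a
  obtain ⟨q₁, hq₁, hqa⟩ := exists_eq_pow_rootMultiplicity_mul_and_not_dvd q hq a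
  rw [dvd_iff_isRoot, IsRoot.def] at hpa hqa
  set n := rootMultiplicity a p
  set m := rootMultiplicity a q
  have hder : ∀ (k : ℕ) (r : ℂ[X]), (X - C a) * derivative ((X - C a) ^ k * r) =
      (X - C a) ^ k * ((k : ℂ[X]) * r + (X - C a) * derivative r) := by
    intro k r
    rcases k with _ | k
    · simp
    · rw [derivative_mul, derivative_X_sub_C_pow, Nat.add_sub_cancel]
      simp only [map_natCast]
      ring
  refine ⟨((n : ℂ[X]) - (m : ℂ[X])) * (q₁ * p₁) +
    (X - C a) * (q₁ * derivative p₁ - derivative q₁ * p₁), ?_, ?_, ?_⟩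
  · have h1 := hder n p₁
    have h2 := hder m q₁
    rw [← hp₁] at h1
    rw [← hq₁] at h2
    calc (X - C a) * (q * derivative p - derivative q * p)
        = q * ((X - C a) * derivative p) - ((X - C a) * derivative q) * p := by ring
      _ = ((X - C a) ^ m * q₁) * ((X - C a) * derivative p) -
          ((X - C a) * derivative q) * ((X - C a) ^ n * p₁) := by rw [← hp₁, ← hq₁]
      _ = _ := by rw [h1, h2, pow_add]; ring
  · intro h
    simp [h]
  · intro h
    have h' : (n : ℂ) - (m : ℂ) ≠ 0 := sub_ne_zero.2 (by exact_mod_cast h.symm)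
    simp [h', hpa, hqa]

theorem eq_C_mul_of_wronskian_eq_zero {p q : ℂ[X]} (hq : q ≠ 0)
    (h : q * derivative p - derivative q * p = 0) : ∃ c : ℂ, p = C c * q := by
  obtain ⟨a, ha⟩ : ∃ a, q.eval a ≠ 0 := by
    by_contra! hall
    exact hq (Polynomial.funext fun a => by rw [hall a, eval_zero])
  refine ⟨p.eval a / q.eval a, ?_⟩
  by_contra hne
  have hr : p - C (p.eval a / q.eval a) * q ≠ 0 := sub_ne_zero.2 hne
  obtain ⟨E, hE, -, hE0⟩ := exists_sub_C_mul_wronskian hr hq a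
  have hzero : q * derivative (p - C (p.eval a / q.eval a) * q) -
      derivative q * (p - C (p.eval a / q.eval a) * q) = 0 := by
    rw [derivative_sub, derivative_C_mul, ← h]
    ring
  rw [hzero, mul_zero, eq_comm, mul_eq_zero, or_iff_right (pow_ne_zero _ (X_sub_C_ne_zero a))] at hE
  have hmq : rootMultiplicity a q = 0 := rootMultiplicity_eq_zero ha
  have hmr : 0 < rootMultiplicity a (p - C (p.eval a / q.eval a) * q) := by
    rw [rootMultiplicity_pos hr, IsRoot.def]
    simp [ha]
  exact hE0 (by omega) (by rw [hE, eval_zero])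

theorem eval_eq_zero_of_wronskian_eq {p q r s : ℂ[X]} (hq : q ≠ 0) {a : ℂ} (hs : s.eval a ≠ 0)
    (h : (X - C a) * s * (q * derivative p - derivative q * p) = r * q ^ 2) : r.eval a = 0 := by
  rcases eq_or_ne p 0 with rfl | hp
  · rw [derivative_zero, mul_zero, mul_zero, sub_zero, mul_zero, eq_comm, mul_eq_zero,
      or_iff_left (pow_ne_zero 2 hq)] at h
    rw [h, eval_zero]
  obtain ⟨E, hE, hE1, hE0⟩ := exists_sub_C_mul_wronskian hp hq a
  obtain ⟨q₁, hq₁, hqa⟩ := exists_eq_pow_rootMultiplicity_mul_and_not_dvd q hq a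
  rw [dvd_iff_isRoot, IsRoot.def] at hqa
  set n := rootMultiplicity a p
  set m := rootMultiplicity a q
  clear_value n m
  have h' : (X - C a) ^ (m + n) * (s * E) = (X - C a) ^ (m + m) * (r * q₁ ^ 2) := by
    calc (X - C a) ^ (m + n) * (s * E) = s * ((X - C a) ^ (m + n) * E) := by ring
      _ = r * q ^ 2 := by rw [← hE, ← h]; ring
      _ = r * ((X - C a) ^ m * q₁) ^ 2 := by rw [← hq₁]
      _ = _ := by ring
  rcases lt_or_ge n m with hlt | hge
  · obtain ⟨d, rfl⟩ : ∃ d, m = n + (d + 1) := ⟨m - n - 1, by omega⟩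
    have h2 : (X - C a) ^ (n + (d + 1) + n) * (s * E) =
        (X - C a) ^ (n + (d + 1) + n) * ((X - C a) ^ (d + 1) * (r * q₁ ^ 2)) := by
      rw [h']; ring
    have h3 := congrArg (eval a) (mul_left_cancel₀ (pow_ne_zero _ (X_sub_C_ne_zero a)) h2)
    simp [hs, hE0 (by omega)] at h3
  · obtain ⟨d, rfl⟩ : ∃ d, n = m + d := ⟨n - m, by omega⟩
    have h2 : (X - C a) ^ (m + m) * ((X - C a) ^ d * (s * E)) =
        (X - C a) ^ (m + m) * (r * q₁ ^ 2) := by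
      rw [← h']; ring
    have h3 := congrArg (eval a) (mul_left_cancel₀ (pow_ne_zero _ (X_sub_C_ne_zero a)) h2)
    rcases d.eq_zero_or_pos with rfl | hd
    · simpa [hE1 rfl, hqa] using h3.symm
    · simpa [hd.ne', hqa] using h3.symm

end PolylogExt

namespace PolylogExt
open Series Filter Topology Polynomial

/-! ### Linear independence of the polylogarithms over the polynomials -/

theorem polynomial_eq_zero_of_Omega {p : ℂ[X]} (h : ∀ z ∈ Omega, p.eval z = 0) : p = 0 := by
  refine eq_zero_of_infinite_isRoot p (Set.Infinite.mono h ?_)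
  have hmem : (Complex.I : ℂ) ∈ Omega := by simp [Omega]
  exact infinite_of_mem_nhds Complex.I (isOpen_Omega.mem_nhds hmem)

/-- The family of coefficients of `z (1 - z) d/dz ∑ c_w Li_w`. -/
noncomputable def relDeriv (c : List Letter → ℂ[X]) (w : List Letter) : ℂ[X] :=
  X * (1 - X) * derivative (c w) + ((1 - X) * c (Letter.x0 :: w) + X * c (Letter.x1 :: w))

theorem hasDerivAt_relation {N : ℕ} {c : List Letter → ℂ[X]}
    (hc : ∀ w, N + 1 ≤ w.length → c w = 0) {z : ℂ} (hz : z ∈ Omega) :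
    HasDerivAt (fun z => ∑ w ∈ wordsLT (N + 1), (c w).eval z * Li w z)
      ((∑ w ∈ wordsLT (N + 1), (relDeriv c w).eval z * Li w z) / (z * (1 - z))) z := by
  have hz0 := ne_zero_of_mem_Omega hz
  have hz1 := one_sub_ne_zero_of_mem_Omega hz
  have hLi : ∀ w, HasDerivAt (Li w) (deriv (Li w) z) z := fun w =>
    ((differentiableOn_Li w).differentiableAt (isOpen_Omega.mem_nhds hz)).hasDerivAt
  refine (HasDerivAt.fun_sum fun w _ => ((c w).hasDerivAt z).mul (hLi w)).congr_deriv ?_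
  have hext : ∀ a : Letter, ∑ w ∈ wordsLT (N + 1), (c (a :: w)).eval z * Li w z =
      ∑ w ∈ wordsLT N, (c (a :: w)).eval z * Li w z := by
    intro a
    symm
    refine Finset.sum_subset (fun w hw => ?_) fun w _ hw => ?_
    · rw [mem_wordsLT] at hw ⊢
      omega
    · rw [mem_wordsLT] at hw
      rw [hc (a :: w) (by simp; omega), eval_zero, zero_mul]
  have h2 : ∑ w ∈ wordsLT (N + 1), (c w).eval z * deriv (Li w) z =
      (∑ w ∈ wordsLT (N + 1), (c (Letter.x0 :: w)).eval z * Li w z) / z +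
        (∑ w ∈ wordsLT (N + 1), (c (Letter.x1 :: w)).eval z * Li w z) / (1 - z) := by
    rw [hext, hext, sum_wordsLT_succ, Li_nil, deriv_const, mul_zero, zero_add, Finset.sum_div,
      Finset.sum_div]
    simp only [(hasDerivAt_Li_x0_cons _ hz).deriv, (hasDerivAt_Li_x1_cons _ hz).deriv,
      mul_div_assoc]
  have h3 : ∑ w ∈ wordsLT (N + 1), (relDeriv c w).eval z * Li w z =
      z * (1 - z) * ∑ w ∈ wordsLT (N + 1), (derivative (c w)).eval z * Li w z +
      ((1 - z) * ∑ w ∈ wordsLT (N + 1), (c (Letter.x0 :: w)).eval z * Li w z +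
        z * ∑ w ∈ wordsLT (N + 1), (c (Letter.x1 :: w)).eval z * Li w z) := by
    simp only [Finset.mul_sum, ← Finset.sum_add_distrib]
    refine Finset.sum_congr rfl fun w _ => ?_
    simp [relDeriv]
    ring
  rw [Finset.sum_add_distrib, h2, h3]
  field_simp

theorem relDeriv_relation {N : ℕ} {c : List Letter → ℂ[X]}
    (hc : ∀ w, N + 1 ≤ w.length → c w = 0)
    (h : ∀ z ∈ Omega, ∑ w ∈ wordsLT (N + 1), (c w).eval z * Li w z = 0) {z : ℂ} (hz : z ∈ Omega) :
    ∑ w ∈ wordsLT (N + 1), (relDeriv c w).eval z * Li w z = 0 := by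
  have h0 : HasDerivAt (fun z => ∑ w ∈ wordsLT (N + 1), (c w).eval z * Li w z) 0 z :=
    (hasDerivAt_const z (0 : ℂ)).congr_of_eventuallyEq
      ((isOpen_Omega.eventually_mem hz).mono h)
  have h1 := (hasDerivAt_relation hc hz).unique h0
  rw [div_eq_zero_iff] at h1
  exact h1.resolve_right (mul_ne_zero (ne_zero_of_mem_Omega hz) (one_sub_ne_zero_of_mem_Omega hz))

theorem not_wronskian_eq_log {p q : ℂ[X]} (hq : q ≠ 0) {α β : ℂ}
    (h : q * (X * (1 - X) * derivative p + ((1 - X) * (C α * q) + X * (C β * q))) -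
      X * (1 - X) * derivative q * p = 0) : α = 0 ∧ β = 0 := by
  constructor
  · have h0 := eval_eq_zero_of_wronskian_eq (p := p) (a := 0) (s := 1 - X)
      (r := -((1 - X) * C α + X * C β)) hq (by simp)
      (by rw [C_0]; linear_combination h)
    simpa using h0
  · have h1 := eval_eq_zero_of_wronskian_eq (p := p) (a := 1) (s := -X)
      (r := -((1 - X) * C α + X * C β)) hq (by simp)
      (by rw [C_1]; linear_combination h)
    simpa using h1

theorem Li_independent (N : ℕ) : ∀ c : List Letter → ℂ[X],
    (∀ w, N ≤ w.length → c w = 0) →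
    (∀ z ∈ Omega, ∑ w ∈ wordsLT N, (c w).eval z * Li w z = 0) → ∀ w, c w = 0 := by
  induction N with
  | zero => exact fun c hc _ w => hc w (Nat.zero_le _)
  | succ N ihN =>
    suffices hk : ∀ (k : ℕ) (c : List Letter → ℂ[X]), (∀ w, N + 1 ≤ w.length → c w = 0) →
        (∀ z ∈ Omega, ∑ w ∈ wordsLT (N + 1), (c w).eval z * Li w z = 0) →
        ((wordsLT (N + 1)).filter fun w => w.length = N ∧ c w ≠ 0).card = k → ∀ w, c w = 0 from
      fun c hc h => hk _ c hc h rfl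
    intro k
    induction k using Nat.strong_induction_on with
    | _ k ihk =>
      intro c hc h hcard
      by_cases htop : ∀ w, w.length = N → c w = 0
      · have hc' : ∀ w, N ≤ w.length → c w = 0 := by
          intro w hw
          rcases hw.eq_or_lt with hw | hw
          · exact htop w hw.symm
          · exact hc w hw
        refine ihN c hc' fun z hz => ?_
        rw [← h z hz]
        refine Finset.sum_subset (fun w hw => ?_) fun w _ hw => ?_
        · rw [mem_wordsLT] at hw ⊢
          omega
        · rw [mem_wordsLT] at hw
          rw [hc' w (by omega), eval_zero, zero_mul]
      exfalso
      push Not at htop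
      obtain ⟨u, hu, hcu⟩ := htop
      set d : List Letter → ℂ[X] := fun w =>
        c u * relDeriv c w - X * (1 - X) * derivative (c u) * c w with hd
      have hdc : ∀ w, N ≤ w.length →
          d w = X * (1 - X) * (c u * derivative (c w) - derivative (c u) * c w) := by
        intro w hw
        simp only [hd, relDeriv]
        rw [hc (Letter.x0 :: w) (by simpa using hw), hc (Letter.x1 :: w) (by simpa using hw)]
        ring
      have hdN : ∀ w, N + 1 ≤ w.length → d w = 0 := by
        intro w hw
        rw [hdc w (by omega), hc w hw]
        simp
      have hdrel : ∀ z ∈ Omega, ∑ w ∈ wordsLT (N + 1), (d w).eval z * Li w z = 0 := by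
        intro z hz
        have hsum : ∑ w ∈ wordsLT (N + 1), (d w).eval z * Li w z =
            (c u).eval z * ∑ w ∈ wordsLT (N + 1), (relDeriv c w).eval z * Li w z -
            (X * (1 - X) * derivative (c u)).eval z *
              ∑ w ∈ wordsLT (N + 1), (c w).eval z * Li w z := by
          rw [Finset.mul_sum, Finset.mul_sum, ← Finset.sum_sub_distrib]
          refine Finset.sum_congr rfl fun w _ => ?_
          simp only [hd, eval_sub, eval_mul]
          ring
        rw [hsum, relDeriv_relation hc h hz, h z hz, mul_zero, mul_zero, sub_zero]
      have hd0 : ∀ w, d w = 0 := by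
        refine ihk _ ?_ d hdN hdrel rfl
        rw [← hcard]
        refine Finset.card_lt_card (Finset.ssubset_iff_of_subset ?_ |>.2 ⟨u, ?_, ?_⟩)
        · intro w hw
          rw [Finset.mem_filter] at hw ⊢
          refine ⟨hw.1, hw.2.1, fun hcw => hw.2.2 ?_⟩
          rw [hdc w hw.2.1.ge, hcw]
          simp
        · rw [Finset.mem_filter, mem_wordsLT]
          exact ⟨by omega, hu, hcu⟩
        · rw [Finset.mem_filter]
          rintro ⟨-, -, hdu⟩
          refine hdu ?_
          rw [hdc u hu.ge]
          ring
      have hprop : ∀ w, w.length = N → ∃ α : ℂ, c w = C α * c u := by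
        intro w hw
        refine eq_C_mul_of_wronskian_eq_zero hcu ?_
        have h1 := hd0 w
        rw [hdc w hw.ge, mul_eq_zero] at h1
        refine h1.resolve_left (mul_ne_zero X_ne_zero fun h1X => ?_)
        simpa using congrArg (eval 0) h1X
      rcases u with _ | ⟨x, v⟩
      · subst hu
        refine hcu (polynomial_eq_zero_of_Omega fun z hz => ?_)
        have := h z hz
        rw [sum_wordsLT_succ] at this
        simpa [wordsLT, Li_nil] using this
      · have hv : ∀ y : Letter, (y :: v).length = N := fun y => by simpa using hu
        obtain ⟨α, hα⟩ := hprop _ (hv Letter.x0)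
        obtain ⟨β, hβ⟩ := hprop _ (hv Letter.x1)
        have h1 := hd0 v
        simp only [hd, relDeriv] at h1
        rw [hα, hβ] at h1
        obtain ⟨rfl, rfl⟩ := not_wronskian_eq_log hcu h1
        cases x
        · exact hcu (by rw [hα]; simp)
        · exact hcu (by rw [hβ]; simp)

theorem eq_zero_of_sum_liHom_eq_zero (f : Polynomial NCPoly)
    (h : ∀ z : Omega, ∑ i ∈ f.support, liHom (f.coeff i) z * (z : ℂ) ^ i = 0) : f = 0 := by
  have hN : ∀ i, ∃ N, LengthLT N (f.coeff i : Series) := fun i => mem_NCPoly_iff.1 (f.coeff i).2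
  choose n hn using hN
  have hN : ∀ i ∈ f.support, LengthLT (f.support.sup n) (f.coeff i : Series) := fun i hi =>
    (hn i).mono (Finset.le_sup hi)
  set N := f.support.sup n
  have hc := Li_independent N
    (fun w => ∑ i ∈ f.support, C ((f.coeff i : Series) w) * X ^ i)
    (fun w hw => Finset.sum_eq_zero fun i hi => by rw [hN i hi w hw, C_0, zero_mul])
    (fun z hz => by
      rw [← h ⟨z, hz⟩]
      simp only [eval_finsetSum, eval_mul, eval_C, eval_pow, eval_X, Finset.sum_mul]
      rw [Finset.sum_comm]
      refine Finset.sum_congr rfl fun i hi => ?_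
      rw [liHom_apply, evalLi_eq_sum (hN i hi), Finset.sum_mul]
      exact Finset.sum_congr rfl fun w _ => by ring)
  ext i w
  by_cases hi : i ∈ f.support
  · have := congrArg (fun p : ℂ[X] => p.coeff i) (hc w)
    simpa [finsetSum_coeff, coeff_X_pow, hi] using this
  · rw [notMem_support_iff.1 hi, coeff_zero]

end PolylogExt

namespace PolylogExt
open Series

/-! ### The morphism on the domain -/

/-- The character `(k, l) ↦ z^k (1 - z)^(-l)`. -/
noncomputable def funChar : Multiplicative (ℤ × ℕ) →* (Omega → ℂ) where
  toFun p z := (z : ℂ) ^ p.toAdd.1 * ((1 - (z : ℂ))⁻¹) ^ p.toAdd.2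
  map_one' := by ext z; simp
  map_mul' p q := by
    ext z
    simp only [toAdd_mul, Prod.fst_add, Prod.snd_add, Pi.mul_apply,
      zpow_add₀ (ne_zero_of_mem_Omega z.2), pow_add]
    ring

/-- The evaluation of a polynomial in the stars as a function on `Ω`. -/
noncomputable def toFunction : StarPoly →ₐ[ℂ] (Omega → ℂ) :=
  AddMonoidAlgebra.liftNCAlgHom liHom funChar fun _ _ => Commute.all _ _

theorem toFunction_single (p : ℤ × ℕ) (P : NCPoly) :
    toFunction (AddMonoidAlgebra.single p P) = liHom P * funChar (Multiplicative.ofAdd p) :=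
  AddMonoidAlgebra.liftNC_single _ _ _ _

theorem funChar_mem_Hol (p : ℤ × ℕ) : funChar (Multiplicative.ofAdd p) ∈ Hol := by
  refine ⟨fun z => z ^ p.1 * ((1 - z)⁻¹) ^ p.2, ?_, fun _ => rfl⟩
  refine DifferentiableOn.mul (fun z hz => ?_) (DifferentiableOn.pow ?_ _)
  · exact (differentiableAt_zpow.2 (Or.inl (ne_zero_of_mem_Omega hz))).differentiableWithinAt
  · exact DifferentiableOn.inv (by fun_prop) fun z hz => one_sub_ne_zero_of_mem_Omega hz

theorem toFunction_mem_Hol (x : StarPoly) : toFunction x ∈ Hol := by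
  induction x using AddMonoidAlgebra.induction_linear with
  | zero => rw [map_zero]; exact zero_mem _
  | add x y hx hy => rw [map_add]; exact add_mem hx hy
  | single p P =>
    rw [toFunction_single]
    exact mul_mem (liHom_mem_Hol P) (funChar_mem_Hol p)

/-- The morphism `Li⁽¹⁾`. -/
noncomputable def liOne : Dom →ₐ[ℂ] Hol :=
  (toFunction.codRestrict Hol toFunction_mem_Hol).comp starPolyEquiv.symm.toAlgHom

theorem coe_liOne {S : Dom} {x : StarPoly} (h : toSeries x = S) :
    (liOne S : Omega → ℂ) = toFunction x := by
  have hS : S = starPolyEquiv x := Subtype.ext h.symm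
  show toFunction (starPolyEquiv.symm S) = _
  rw [hS, AlgEquiv.symm_apply_apply]

theorem coe_liOne_inclusion (P : NCPoly) :
    (liOne (Subalgebra.inclusion NCPoly_le_Dom P) : Omega → ℂ) = liHom P := by
  rw [coe_liOne (toSeries_poly P), toFunction_single, ofAdd_zero, map_one, mul_one]

theorem coe_liOne_x0Star : (liOne Dom.x0Star : Omega → ℂ) = fz := by
  rw [coe_liOne toSeries_x0Star, toFunction_single, map_one, one_mul]
  ext z
  simp [funChar, fz]

theorem coe_liOne_negX0Star : (liOne Dom.negX0Star : Omega → ℂ) = fzInv := by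
  rw [coe_liOne toSeries_negX0Star, toFunction_single, map_one, one_mul]
  ext z
  simp [funChar, fzInv]

theorem coe_liOne_x1Star : (liOne Dom.x1Star : Omega → ℂ) = fOneSubInv := by
  rw [coe_liOne toSeries_x1Star, toFunction_single, map_one, one_mul]
  ext z
  simp [funChar, fOneSubInv]

theorem coe_liOne_word (w : List Letter) : (liOne (Dom.word w) : Omega → ℂ) = LiOn w := by
  refine (coe_liOne_inclusion ⟨word w, word_mem_NCPoly w⟩).trans ?_
  ext z
  exact evalLi_word w z

theorem isLiOne_liOne : IsLiOne liOne :=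
  ⟨coe_liOne_word, coe_liOne_x0Star, coe_liOne_negX0Star, coe_liOne_x1Star⟩

theorem IsLiOne.eq {Φ Ψ : Dom →ₐ[ℂ] Hol} (hΦ : IsLiOne Φ) (hΨ : IsLiOne Ψ) : Ψ = Φ := by
  suffices h : ∀ S ∈ Dom, ∃ T : Dom, (T : Series) = S ∧ Ψ T = Φ T by
    ext S : 1
    obtain ⟨T, hT, h⟩ := h S S.2
    rwa [Subtype.ext hT] at h
  intro S hS
  induction hS using Algebra.adjoin_induction with
  | mem S hS =>
    rcases hS with hS | rfl | rfl | rfl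
    · obtain ⟨N, hN⟩ := mem_polynomials_iff.1 hS
      refine ⟨∑ w ∈ wordsLT N, S w • Dom.word w, ?_, ?_⟩
      · conv_rhs => rw [hN.eq_sum]
        rw [AddSubmonoidClass.coe_finsetSum]
        rfl
      · simp only [map_sum, map_smul]
        refine Finset.sum_congr rfl fun w _ => ?_
        rw [Subtype.ext ((hΨ.word w).trans (hΦ.word w).symm)]
    · exact ⟨Dom.x0Star, rfl, Subtype.ext (hΨ.x0Star.trans hΦ.x0Star.symm)⟩
    · exact ⟨Dom.negX0Star, rfl, Subtype.ext (hΨ.negX0Star.trans hΦ.negX0Star.symm)⟩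
    · exact ⟨Dom.x1Star, rfl, Subtype.ext (hΨ.x1Star.trans hΦ.x1Star.symm)⟩
  | algebraMap c => exact ⟨algebraMap ℂ Dom c, rfl, by rw [Ψ.commutes, Φ.commutes]⟩
  | add S T _ _ ihS ihT =>
    obtain ⟨S', rfl, hS⟩ := ihS
    obtain ⟨T', rfl, hT⟩ := ihT
    exact ⟨S' + T', rfl, by rw [map_add, map_add, hS, hT]⟩
  | mul S T _ _ ihS ihT =>
    obtain ⟨S', rfl, hS⟩ := ihS
    obtain ⟨T', rfl, hT⟩ := ihT
    exact ⟨S' * T', rfl, by rw [map_mul, map_mul, hS, hT]⟩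

/-! ### The image -/

theorem funChar_mem_CC (p : ℤ × ℕ) : funChar (Multiplicative.ofAdd p) ∈ CC := by
  have h0 : fz ∈ CC := Algebra.subset_adjoin (by simp)
  have h1 : fzInv ∈ CC := Algebra.subset_adjoin (by simp)
  have h2 : fOneSubInv ∈ CC := Algebra.subset_adjoin (by simp)
  obtain ⟨k, l⟩ := p
  obtain ⟨n, rfl | rfl⟩ := k.eq_nat_or_neg
  · convert mul_mem (pow_mem h0 n) (pow_mem h2 l) using 1
    ext z
    simp [funChar, fz, fOneSubInv]
  · convert mul_mem (pow_mem h1 n) (pow_mem h2 l) using 1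
    ext z
    simp [funChar, fzInv, fOneSubInv]

theorem liHom_mem_span (P : NCPoly) :
    liHom P ∈ Submodule.span CC (Set.range LiOn) := by
  obtain ⟨N, hN⟩ := mem_NCPoly_iff.1 P.2
  have h : liHom P = ∑ w ∈ wordsLT N, algebraMap ℂ CC ((P : Series) w) • LiOn w := by
    ext z
    rw [liHom_apply, evalLi_eq_sum hN, Finset.sum_apply]
    rfl
  rw [h]
  exact sum_mem fun w _ => Submodule.smul_mem _ _ (Submodule.subset_span ⟨w, rfl⟩)

theorem coe_liOne_mem_span (S : Dom) :
    (liOne S : Omega → ℂ) ∈ Submodule.span CC (Set.range LiOn) := by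
  rw [coe_liOne (x := starPolyEquiv.symm S)
    (congrArg Subtype.val (starPolyEquiv.apply_symm_apply S))]
  induction starPolyEquiv.symm S using AddMonoidAlgebra.induction_linear with
  | zero => rw [map_zero]; exact zero_mem _
  | add x y hx hy => rw [map_add]; exact add_mem hx hy
  | single p P =>
    rw [toFunction_single, mul_comm]
    exact Submodule.smul_mem _ (⟨_, funChar_mem_CC p⟩ : CC) (liHom_mem_span P)

/-- The image of `Li⁽¹⁾` as an algebra of functions on `Ω`. -/
noncomputable def liOneRange : Subalgebra ℂ (Omega → ℂ) := (Hol.val.comp liOne).range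

theorem CC_le_liOneRange : CC ≤ liOneRange := by
  refine Algebra.adjoin_le ?_
  rintro f (rfl | rfl | rfl)
  · exact ⟨_, coe_liOne_x0Star⟩
  · exact ⟨_, coe_liOne_negX0Star⟩
  · exact ⟨_, coe_liOne_x1Star⟩

theorem adjoin_le_liOneRange {f : Omega → ℂ} (hf : f ∈ Algebra.adjoin CC (Set.range LiOn)) :
    f ∈ liOneRange := by
  induction hf using Algebra.adjoin_induction with
  | mem f hf =>
    obtain ⟨w, rfl⟩ := hf
    exact ⟨_, coe_liOne_word w⟩
  | algebraMap c => exact CC_le_liOneRange c.2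
  | add f g _ _ hf hg => exact add_mem hf hg
  | mul f g _ _ hf hg => exact mul_mem hf hg

/-! ### The kernel -/

theorem coe_liOne_evalX0Star (f : Polynomial NCPoly) (z : Omega) :
    (liOne (evalX0Star f) : Omega → ℂ) z =
      ∑ i ∈ f.support, liHom (f.coeff i) z * (z : ℂ) ^ i := by
  have h : evalX0Star f = ∑ i ∈ f.support,
      Subalgebra.inclusion NCPoly_le_Dom (f.coeff i) * Dom.x0Star ^ i :=
    Polynomial.eval₂_eq_sum
  rw [h]
  simp only [map_sum, map_mul, map_pow, AddSubmonoidClass.coe_finsetSum, MulMemClass.coe_mul,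
    SubmonoidClass.coe_pow, coe_liOne_inclusion, coe_liOne_x0Star, Finset.sum_apply,
    Pi.mul_apply, Pi.pow_apply, fz]

theorem starIdeal_le_ker : starIdeal ≤ RingHom.ker liOne := by
  rw [starIdeal, Ideal.span_singleton_le_iff_mem, RingHom.mem_ker]
  apply Subtype.ext
  simp only [map_add, map_sub, map_mul, map_one, AddMemClass.coe_add, AddSubgroupClass.coe_sub,
    MulMemClass.coe_mul, OneMemClass.coe_one, coe_liOne_x0Star, coe_liOne_x1Star]
  ext z
  have h := one_sub_ne_zero_of_mem_Omega z.2
  simp only [fz, fOneSubInv, Pi.add_apply, Pi.sub_apply, Pi.mul_apply, Pi.one_apply]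
  show (z : ℂ) * (1 - (z : ℂ))⁻¹ - (1 - (z : ℂ))⁻¹ + 1 = 0
  field_simp
  ring

theorem ker_liOne : RingHom.ker liOne = starIdeal := by
  refine le_antisymm (fun S hS => ?_) starIdeal_le_ker
  obtain ⟨M, N, f, h⟩ := isCleared S
  have hf : liOne (evalX0Star f) = 0 := by
    have h1 := (RingHom.mem_ker).1 (starIdeal_le_ker h)
    rw [map_sub, map_mul, (RingHom.mem_ker).1 hS, mul_zero, zero_sub, neg_eq_zero] at h1
    exact h1
  have hf0 : f = 0 := eq_zero_of_sum_liHom_eq_zero f fun z => by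
    rw [← coe_liOne_evalX0Star, hf]
    rfl
  rw [hf0, map_zero, sub_zero] at h
  exact mem_starIdeal_of_cleared h

end PolylogExt

theorem mainTheorem1 :
    ∃ Φ : PolylogExt.Dom →ₐ[ℂ] PolylogExt.Hol,
      PolylogExt.IsLiOne Φ ∧
      (∀ Ψ : PolylogExt.Dom →ₐ[ℂ] PolylogExt.Hol, PolylogExt.IsLiOne Ψ → Ψ = Φ) ∧
      Set.range (fun S : PolylogExt.Dom => (Φ S : PolylogExt.Omega → ℂ)) =
        (Submodule.span PolylogExt.CC (Set.range PolylogExt.LiOn) : Set (PolylogExt.Omega → ℂ)) ∧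
      Set.range (fun S : PolylogExt.Dom => (Φ S : PolylogExt.Omega → ℂ)) =
        (Algebra.adjoin PolylogExt.CC (Set.range PolylogExt.LiOn) : Set (PolylogExt.Omega → ℂ)) ∧
      RingHom.ker Φ = Ideal.span
        {PolylogExt.Dom.x0Star * PolylogExt.Dom.x1Star - PolylogExt.Dom.x1Star + 1} := by
  have h1 : Set.range (fun S : PolylogExt.Dom => (PolylogExt.liOne S : PolylogExt.Omega → ℂ)) ⊆
      (Submodule.span PolylogExt.CC (Set.range PolylogExt.LiOn) :
        Set (PolylogExt.Omega → ℂ)) := by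
    rintro _ ⟨S, rfl⟩
    exact PolylogExt.coe_liOne_mem_span S
  have h2 : (Submodule.span PolylogExt.CC (Set.range PolylogExt.LiOn) :
      Set (PolylogExt.Omega → ℂ)) ⊆
      (Algebra.adjoin PolylogExt.CC (Set.range PolylogExt.LiOn) : Set (PolylogExt.Omega → ℂ)) :=
    fun _ hf => Algebra.span_le_adjoin _ _ hf
  have h3 : (Algebra.adjoin PolylogExt.CC (Set.range PolylogExt.LiOn) :
      Set (PolylogExt.Omega → ℂ)) ⊆
      Set.range (fun S : PolylogExt.Dom => (PolylogExt.liOne S : PolylogExt.Omega → ℂ)) :=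
    fun _ hf => PolylogExt.adjoin_le_liOneRange hf
  exact ⟨PolylogExt.liOne, PolylogExt.isLiOne_liOne, fun _ hΨ => PolylogExt.isLiOne_liOne.eq hΨ,
    h1.antisymm (h2.trans h3), (h1.trans h2).antisymm h3, PolylogExt.ker_liOne⟩
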